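/- **Markov processes on distributions.** For a measurable space $S$ let $\mathcal D(S)$ be the set of probability measures on $S$ with the Giry $\sigma$-algebra. A non-deterministic labelled Markov process (NLMP) has measurable spaces $S$ of states and $L$ of labels and measurable sets $\tau_a(s)\subseteq\mathcal D(S)$ ($a\in L$, $s\in S$) such that $\{(a,\mu)\mid \mu\in\tau_a(s)\}$ is measurable for each $s$ and $\{s\mid \exists a\in A:\ \tau_a(s)\cap Y\ne\emptyset\}$ is measurable for all measurable $A\subseteq L$, $Y\subseteq\mathcal D(S)$. Write $s\xrightarrow{a}\mu$ if $\mu=\int \mu'\,\nu(d\mu')$ for a probability measure $\nu$ on $\mathcal D(S)$ with $\nu(\tau_a(s))=1$. For measurable $A\subseteq L$ write $s\xrightarrow{A}\mu$ if $s\xrightarrow{a}\mu$ for some $a\in A$, and let $S_A=\{s\mid\exists\mu:\ s\xrightarrow{A}\mu\}$. For $\mu,\mu'\in\mathcal D(S)$ write $\mu\xrightarrow{A}\mu'$ if $\mu(S_A)>0$ and $\mu'=\frac1{\mu(S_A)}\int_{S_A}\nu_s\,\mu(ds)$ for some measurable $s\mapsto\nu_s$ with $s\xrightarrow{A}\nu_s$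 for all $s\in S_A$. A symmetric relation $R$ on $\mathcal D(S)$ is a bisimulation if for all $\mu\,R\,\nu$ and all measurable $A\subseteq L$: (1) $\mu(S_A)=\nu(S_A)$, and (2) for each $\mu\xrightarrow{A}\mu'$ there is $\nu\xrightarrow{A}\nu'$ with $\mu'\,R\,\nu'$. Write $\mu\sim\nu$ if $\mu\,R\,\nu$ for some bisimulation $R$. **Stochastic automata.** A stochastic automaton (SA) consists of finite sets $\mathcal Q$ of locations, $\mathcal C$ of clocks and $\mathcal A$ of actions, a set of edges $\to\ \subseteq\mathcal Q\times\mathcal A\times 2^{\mathcal C}\times\mathcal Q$, a map $\kappa:\mathcal Q\to2^{\mathcal C}$, and a probability distribution $F(c)$ on $\mathbb R_{\ge0}$ for each clock $c$. Its semantics is the NLMP with states $(q,\xi)\in\mathcal Q\times\mathbb R^{\mathcal C}$ and labels $(a,t)\in\mathcal A\times\mathbb R_{\ge0}$ in which $\tau_{(a,t)}(q,\xi)$ is the following set. The idling time of $(q,\xi)$ is the least $t\ge0$ such that some edge $(q,a',X,q')$ is enabled at $t$, i.e. $\xi(c)-t\le0$ for all $c\in X$. If $t$ is the idling time, $\tau_{(a,t)}(q,\xi)$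 consists of the measures $\mu_e$ for the edges $e=(q,a,X,q')$ that are enabled at $t$, where under $\mu_e$ the location is $q'$ and the clocks are independent, with law $F(c)$ for $c\in\kappa(q')$ and with value $\xi(c)-t$ for $c\notin\kappa(q')$; otherwise $\tau_{(a,t)}(q,\xi)=\emptyset$. Two locations $q_1,q_2$ of one SA are bisimilar if $\mu_{q_1}\sim\mu_{q_2}$, where under $\mu_q$ the location is $q$ and the clocks are independent, with law $F(c)$ for $c\in\kappa(q)$ and with value $0$ otherwise. Two SA with initial locations and the same actions are bisimilar ($\sim$) if their initial locations are bisimilar in the disjoint union of the two SA. For SA $\mathcal S_1,\mathcal S_2$ with initial locations $q_1,q_2$, the interleaving parallel composition $\mathcal S_1\parallel_{SA}\mathcal S_2$ has locations $\mathcal Q_1\times\mathcal Q_2\times\{0,1,2\}$, initial location $(q_1,q_2,0)$, the disjoint union of the clocks with the distributions they have in $\mathcal S_1$ and $\mathcal S_2$, edges $((p,r,b),a,X,(p',r,1))$ for all $(p,a,X,p')\in\to_1$ and $((r,p,b),a,X,(r,p',2))$ for all $(p,a,X,p')\in\to_2$ (with arbitrary $r$ and $b$), and $\kappa(p_1,p_2,0)=\kappa_1(p_1)\cup\kappa_2(p_2)$,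 $\kappa(p_1,p_2,b)=\kappa_b(p_b)$ for $b\in\{1,2\}$. **Continuous-time Markov chains.** A CTMC $\mathcal C=(S,Q)$ consists of a finite set $S$ of states, an initial state, and a matrix of rates $Q:S\times S\to\mathbb R_{\ge0}$; $Q(s,s')=0$ means that there is no transition from $s$ to $s'$. The parallel composition $\mathcal C_1\parallel_{CT}\mathcal C_2$ has states $S_1\times S_2$, the pair of the initial states as initial state, and as rate matrix the Kronecker sum $Q_1\otimes I+I\otimes Q_2$. The stochastic automaton $SA(\mathcal C)$ has locations $S$ with the same initial state, clocks $S\times S$, one action $L$, an edge $(s,L,\{(s,s')\},s')$ for all $s,s'$ with $Q(s,s')>0$, $\kappa(s)=\{(s,s')\mid Q(s,s')>0\}$, and $F((s,s'))=\mathrm{Exp}(Q(s,s'))$ whenever $Q(s,s')>0$ (the other clocks are never set nor tested). **Theorem.** For all CTMCs $\mathcal C_1,\mathcal C_2$ (with arbitrary initial states), $$SA(\mathcal C_1)\parallel_{SA}SA(\mathcal C_2)\ \sim\ SA(\mathcal C_1\parallel_{CT}\mathcal C_2).$$ -/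

import Mathlib

open MeasureTheory
open scoped NNReal ENNReal Kronecker

/-! ### Non-deterministic labelled Markov processes and bisimulation on distributions -/

/-- A non-deterministic labelled Markov process with state space `S` and label space `L`.
`ProbabilityMeasure S` carries the Giry σ-algebra. -/
structure NLMP (S L : Type*) [MeasurableSpace S] [MeasurableSpace L] where
  /-- `trans a s` is the set of probability measures available in `s` under `a`. -/
  trans : L → S → Set (ProbabilityMeasure S)
  measurableSet_trans : ∀ a s, MeasurableSet (trans a s)
  measurableSet_graph : ∀ s, MeasurableSet {p : L × ProbabilityMeasure S | p.2 ∈ trans p.1 s}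
  measurableSet_hit : ∀ (A : Set L) (Y : Set (ProbabilityMeasure S)),
    MeasurableSet A → MeasurableSet Y → MeasurableSet {s | ∃ a ∈ A, (trans a s ∩ Y).Nonempty}

/-- `μ` is a (generalised) convex combination of the set `M` of distributions: the barycentre
`∫ m dν(m)` of a probability measure `ν` on distributions with `ν(M) = 1`. -/
def IsConvexCombination {S : Type*} [MeasurableSpace S]
    (M : Set (ProbabilityMeasure S)) (μ : ProbabilityMeasure S) : Prop :=
  ∃ ν : ProbabilityMeasure (ProbabilityMeasure S), (ν : Measure (ProbabilityMeasure S)) M = 1 ∧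
    ∀ B : Set S, MeasurableSet B →
      (μ : Measure S) B =
        ∫⁻ m : ProbabilityMeasure S, (m : Measure S) B ∂(ν : Measure (ProbabilityMeasure S))

namespace NLMP

variable {S L : Type*} [MeasurableSpace S] [MeasurableSpace L]

/-- `s —a→ μ`. -/
def Step (P : NLMP S L) (a : L) (s : S) (μ : ProbabilityMeasure S) : Prop :=
  IsConvexCombination (P.trans a s) μ

/-- `s —A→ μ` for a set `A` of labels. -/
def SetStep (P : NLMP S L) (A : Set L) (s : S) (μ : ProbabilityMeasure S) : Prop :=
  ∃ a ∈ A, P.Step a s μ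

/-- `S_A`, the set of states that have an outgoing step with a label from `A`. -/
def active (P : NLMP S L) (A : Set L) : Set S :=
  {s | ∃ μ, P.SetStep A s μ}

/-- `μ —A→ μ'` for distributions: `μ' = (1 / μ(S_A)) ∫_{s ∈ S_A} f(s) dμ(s)` for some measurable
`f` with `s —A→ f(s)` for all `s ∈ S_A` (the values of `f` outside of `S_A` play no role). -/
def DistStep (P : NLMP S L) (A : Set L) (μ μ' : ProbabilityMeasure S) : Prop :=
  (μ : Measure S) (P.active A) ≠ 0 ∧
    ∃ f : S → ProbabilityMeasure S, Measurable f ∧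
      (∀ s ∈ P.active A, P.SetStep A s (f s)) ∧
      ∀ B : Set S, MeasurableSet B →
        (μ' : Measure S) B = ((μ : Measure S) (P.active A))⁻¹ *
          ∫⁻ s in P.active A, (f s : Measure S) B ∂(μ : Measure S)

/-- Probabilistic bisimulations: symmetric relations on distributions over states. -/
structure IsBisimulation (P : NLMP S L)
    (R : ProbabilityMeasure S → ProbabilityMeasure S → Prop) : Prop where
  symm : ∀ μ ν, R μ ν → R ν μ
  mass_eq : ∀ μ ν, R μ ν → ∀ A : Set L, MeasurableSet A →
    (μ : Measure S) (P.active A) = (ν : Measure S) (P.active A)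
  step : ∀ μ ν, R μ ν → ∀ A : Set L, MeasurableSet A →
    ∀ μ', P.DistStep A μ μ' → ∃ ν', P.DistStep A ν ν' ∧ R μ' ν'

/-- `μ ∼ ν`. -/
def Bisimilar (P : NLMP S L) (μ ν : ProbabilityMeasure S) : Prop :=
  ∃ R : ProbabilityMeasure S → ProbabilityMeasure S → Prop, P.IsBisimulation R ∧ R μ ν

end NLMP

/-! ### Stochastic automata -/

/-- A stochastic automaton with locations `Q`, clocks `C` and actions `A`. -/
structure StochasticAutomaton (Q C A : Type*) where
  /-- `edge q a X q'`: there is an edge from `q` to `q'` with action `a` and trigger set `X`. -/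
  edge : Q → A → Set C → Q → Prop
  /-- The clock setting function `κ`. -/
  reset : Q → Set C
  /-- The distribution `F c` of a clock `c`. -/
  law : C → Measure ℝ
  law_prob : ∀ c, IsProbabilityMeasure (law c)
  law_nonneg : ∀ c, law c (Set.Iio 0) = 0

attribute [instance] StochasticAutomaton.law_prob

/-- States `(q, ξ)`: the current location and the current values of the clocks. -/
@[ext]
structure SAState (Q C : Type*) where
  loc : Q
  clock : C → ℝ

/-- Labels `(a, t)`: an action and the idling time that precedes it. -/
@[ext]
structure SALabel (A : Type*) where
  act : A
  time : ℝ≥0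

/-- The product σ-algebra of the discrete σ-algebra on the locations and the product of the Borel
σ-algebras on the clock values. -/
instance SAState.instMeasurableSpace (Q C : Type*) : MeasurableSpace (SAState Q C) :=
  MeasurableSpace.comap SAState.loc ⊤ ⊔ MeasurableSpace.comap SAState.clock MeasurableSpace.pi

/-- The product σ-algebra of the discrete σ-algebra on the actions and the Borel σ-algebra on the
idling times. -/
instance SALabel.instMeasurableSpace (A : Type*) : MeasurableSpace (SALabel A) :=
  MeasurableSpace.comap SALabel.act ⊤ ⊔ MeasurableSpace.comap SALabel.time inferInstance

lemma SAState.measurable_mk {Q C : Type*} (q : Q) :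
    Measurable (fun ξ : C → ℝ => (⟨q, ξ⟩ : SAState Q C)) := by
  rw [measurable_iff_comap_le, SAState.instMeasurableSpace, MeasurableSpace.comap_sup,
    MeasurableSpace.comap_comp, MeasurableSpace.comap_comp]
  refine sup_le ?_ ?_
  · rintro _ ⟨B, -, rfl⟩
    exact MeasurableSet.const (q ∈ B)
  · exact measurable_id.comap_le

lemma SAState.measurable_clock {Q C : Type*} : Measurable (SAState.clock : SAState Q C → C → ℝ) :=
  measurable_iff_comap_le.2 le_sup_right

lemma SAState.measurableSet_loc {Q C : Type*} (q : Q) :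
    MeasurableSet {s : SAState Q C | s.loc = q} :=
  (le_sup_left : MeasurableSpace.comap SAState.loc ⊤ ≤ SAState.instMeasurableSpace Q C) _
    ⟨{q}, trivial, rfl⟩

lemma SALabel.measurable_mk {A : Type*} (a : A) :
    Measurable (fun t : ℝ≥0 => (⟨a, t⟩ : SALabel A)) := by
  rw [measurable_iff_comap_le, SALabel.instMeasurableSpace, MeasurableSpace.comap_sup,
    MeasurableSpace.comap_comp, MeasurableSpace.comap_comp]
  refine sup_le ?_ ?_
  · rintro _ ⟨B, -, rfl⟩
    exact MeasurableSet.const (a ∈ B)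
  · exact measurable_id.comap_le

instance SAState.instCountablyGenerated (Q C : Type*) [Finite Q] [Finite C] :
    MeasurableSpace.CountablyGenerated (SAState Q C) := by
  let m : MeasurableSpace Q := ⊤
  have : DiscreteMeasurableSpace Q := ⟨fun _ => trivial⟩
  exact MeasurableSpace.CountablyGenerated.sup (.comap SAState.loc) (.comap SAState.clock)

instance SALabel.instMeasurableSingletonClass (A : Type*) :
    MeasurableSingletonClass (SALabel A) := by
  refine ⟨fun l => ?_⟩
  have h1 : MeasurableSet {l' : SALabel A | l'.act = l.act} :=
    (le_sup_left : MeasurableSpace.comap SALabel.act ⊤ ≤ SALabel.instMeasurableSpace A) _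
      ⟨{l.act}, trivial, rfl⟩
  have h2 : MeasurableSet {l' : SALabel A | l'.time = l.time} :=
    (le_sup_right : MeasurableSpace.comap SALabel.time _ ≤ SALabel.instMeasurableSpace A) _
      ⟨{l.time}, measurableSet_singleton _, rfl⟩
  convert h1.inter h2
  ext l'
  exact SALabel.ext_iff

lemma ProbabilityMeasure.measurable_eval {S : Type*} [MeasurableSpace S] {B : Set S}
    (hB : MeasurableSet B) : Measurable (fun m : ProbabilityMeasure S => (m : Measure S) B) :=
  (Measure.measurable_coe hB).comp measurable_subtype_coe

instance ProbabilityMeasure.instMeasurableSingletonClass {S : Type*} [MeasurableSpace S]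
    [MeasurableSpace.CountablyGenerated S] :
    MeasurableSingletonClass (ProbabilityMeasure S) := by
  refine ⟨fun μ => ?_⟩
  obtain ⟨b, hbc, hb⟩ := MeasurableSpace.CountablyGenerated.isCountablyGenerated (α := S)
  have hD : (generateSetAlgebra b).Countable := countable_generateSetAlgebra hbc
  have hgen : ‹MeasurableSpace S› = MeasurableSpace.generateFrom (generateSetAlgebra b) := by
    rw [generateFrom_generateSetAlgebra_eq]; exact hb
  have hmeas : ∀ s ∈ generateSetAlgebra b, MeasurableSet s := fun s hs => by
    rw [hgen]; exact MeasurableSpace.measurableSet_generateFrom hs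
  have : ({μ} : Set (ProbabilityMeasure S)) =
      ⋂ s ∈ generateSetAlgebra b, {m : ProbabilityMeasure S | (m : Measure S) s = (μ : Measure S) s} := by
    ext m
    simp only [Set.mem_singleton_iff, Set.mem_iInter]
    constructor
    · rintro rfl s _; rfl
    · intro h
      have := m.2
      refine Subtype.ext (ext_of_generate_finite (μ := m.1) _ hgen
        isSetAlgebra_generateSetAlgebra.isSetRing.isSetSemiring.isPiSystem h ?_)
      exact (@measure_univ _ _ _ m.2).trans (@measure_univ _ _ _ μ.2).symm
  rw [this]
  exact MeasurableSet.biInter hD fun s hs =>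
    ProbabilityMeasure.measurable_eval (hmeas s hs) (measurableSet_singleton _)

namespace StochasticAutomaton

variable {Q C A : Type*}

open Classical in
/-- The law of the state `(q, ξ)` right after entering `q` with clock values `η`: the location is
`q`, the clocks are independent, `ξ c` has law `F c` if `c ∈ κ(q)`, and `ξ c = η c` otherwise. -/
noncomputable def enterMeasure [Fintype C] (M : StochasticAutomaton Q C A) (q : Q) (η : C → ℝ) :
    Measure (SAState Q C) :=
  (Measure.pi fun c => if c ∈ M.reset q then M.law c else Measure.dirac (η c)).map
    fun ξ => ⟨q, ξ⟩

open Classical in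
lemma enterMeasure_eq_map [Fintype C] (M : StochasticAutomaton Q C A) (q : Q) (η : C → ℝ) :
    M.enterMeasure q η = (Measure.pi fun c => M.law c).map
      (fun ζ => ⟨q, fun c => if c ∈ M.reset q then ζ c else η c⟩) := by
  have hf : ∀ c, Measurable (fun x : ℝ => if c ∈ M.reset q then x else η c) := fun c => by
    split_ifs
    · exact measurable_id
    · exact measurable_const
  have hp : ∀ c, IsProbabilityMeasure
      ((M.law c).map (fun x : ℝ => if c ∈ M.reset q then x else η c)) := fun c =>
    Measure.isProbabilityMeasure_map (hf c).aemeasurable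
  have h := Measure.pi_map_pi (μ := fun c => M.law c)
    (f := fun c (x : ℝ) => if c ∈ M.reset q then x else η c) (fun c => (hf c).aemeasurable)
  have h2 : (fun c => if c ∈ M.reset q then M.law c else Measure.dirac (η c)) =
      fun c => (M.law c).map (fun x : ℝ => if c ∈ M.reset q then x else η c) := by
    funext c
    split_ifs
    · exact Measure.map_id.symm
    · simp
  have hm : Measurable fun (ζ : C → ℝ) (c : C) => if c ∈ M.reset q then ζ c else η c :=
    measurable_pi_lambda _ fun c => (hf c).comp (measurable_pi_apply c)
  rw [enterMeasure, h2, ← h, Measure.map_map (SAState.measurable_mk q) hm]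
  rfl

instance [Fintype C] (M : StochasticAutomaton Q C A) (q : Q) (η : C → ℝ) :
    IsProbabilityMeasure (M.enterMeasure q η) := by
  classical
  have : ∀ c, IsProbabilityMeasure
      (if c ∈ M.reset q then M.law c else Measure.dirac (η c)) := fun c => by
    split_ifs <;> infer_instance
  unfold enterMeasure
  exact Measure.isProbabilityMeasure_map (SAState.measurable_mk q).aemeasurable

/-- `enterMeasure` as a probability measure. -/
noncomputable def enter [Fintype C] (M : StochasticAutomaton Q C A) (q : Q) (η : C → ℝ) :
    ProbabilityMeasure (SAState Q C) :=
  ⟨M.enterMeasure q η, inferInstance⟩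

lemma measurable_enter [Fintype C] (M : StochasticAutomaton Q C A) (q : Q) :
    Measurable (M.enter q) := by
  classical
  refine Measurable.subtype_mk (Measure.measurable_of_measurable_coe _ fun B hB => ?_)
  have hg : Measurable (fun p : (C → ℝ) × (C → ℝ) =>
      (⟨q, fun c => if c ∈ M.reset q then p.2 c else p.1 c⟩ : SAState Q C)) := by
    refine (SAState.measurable_mk q).comp (measurable_pi_lambda _ fun c => ?_)
    split_ifs <;> fun_prop
  have : (fun η => M.enterMeasure q η B) = fun η =>
      (Measure.pi fun c => M.law c) (Prod.mk η ⁻¹' ((fun p : (C → ℝ) × (C → ℝ) =>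
      (⟨q, fun c => if c ∈ M.reset q then p.2 c else p.1 c⟩ : SAState Q C)) ⁻¹' B)) := by
    funext η
    rw [enterMeasure_eq_map, Measure.map_apply _ hB]
    · congr!
    · convert hg.comp (measurable_prodMk_left (x := η)) using 3
      simp only [Function.comp_apply]
      congr!
  rw [this]
  exact measurable_measure_prodMk_left (hg hB)

/-- An edge with trigger set `X` is enabled after time `t` if all its clocks, which started with
the values `ξ`, are `≤ 0` by then. -/
def Enabled (X : Set C) (ξ : C → ℝ) (t : ℝ≥0) : Prop := ∀ c ∈ X, ξ c - t ≤ 0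

/-- `t` is the idling time in the state `s`: the first time when an edge becomes enabled. -/
def IsIdlingTime (M : StochasticAutomaton Q C A) (s : SAState Q C) (t : ℝ≥0) : Prop :=
  IsLeast {t : ℝ≥0 | ∃ a X q', M.edge s.loc a X q' ∧ Enabled X s.clock t} t

/-- The distributions available in a state under the label `(a, t)`: if `t` is the idling time,
each edge with action `a` that is enabled at time `t` can be taken; all clocks decrease by `t`, and
the new location is entered. -/
def trans [Fintype C] (M : StochasticAutomaton Q C A) (l : SALabel A) (s : SAState Q C) :
    Set (ProbabilityMeasure (SAState Q C)) :=
  {μ | M.IsIdlingTime s l.time ∧ ∃ X q', M.edge s.loc l.act X q' ∧ Enabled X s.clock l.time ∧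
    μ = M.enter q' fun c => s.clock c - l.time}

open Classical in
/-- The time when an edge with trigger set `X` becomes enabled. -/
noncomputable def enablingTime [Fintype C] (X : Set C) (ξ : C → ℝ) : ℝ≥0 :=
  Finset.univ.sup fun c => if c ∈ X then (ξ c).toNNReal else 0

lemma enabled_iff [Fintype C] (X : Set C) (ξ : C → ℝ) (t : ℝ≥0) :
    Enabled X ξ t ↔ enablingTime X ξ ≤ t := by
  classical
  unfold Enabled enablingTime
  simp only [Finset.sup_le_iff, Finset.mem_univ, true_implies, sub_nonpos]
  refine forall_congr' fun c => ?_
  by_cases h : c ∈ X <;> simp [h, Real.toNNReal_le_iff_le_coe]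

lemma measurable_enablingTime [Fintype C] (X : Set C) :
    Measurable (enablingTime X : (C → ℝ) → ℝ≥0) := by
  classical
  refine measurable_of_Iic fun t => ?_
  have : (enablingTime X : (C → ℝ) → ℝ≥0) ⁻¹' Set.Iic t = ⋂ c ∈ X, {ξ : C → ℝ | ξ c - t ≤ 0} := by
    ext ξ
    simpa [Enabled] using (enabled_iff X ξ t).symm
  rw [this]
  exact MeasurableSet.biInter (Set.to_countable X) fun c _ =>
    measurableSet_le (by fun_prop) measurable_const

lemma isIdlingTime_iff [Fintype C] (M : StochasticAutomaton Q C A) (s : SAState Q C) (t : ℝ≥0) :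
    M.IsIdlingTime s t ↔ (∃ a X q', M.edge s.loc a X q' ∧ t = enablingTime X s.clock) ∧
      ∀ a X q', M.edge s.loc a X q' → t ≤ enablingTime X s.clock := by
  unfold IsIdlingTime
  simp only [enabled_iff]
  constructor
  · rintro ⟨⟨a, X, q', he, h⟩, hl⟩
    have hl' : ∀ a X q', M.edge s.loc a X q' → t ≤ enablingTime X s.clock :=
      fun a X q' he => hl ⟨a, X, q', he, le_rfl⟩
    exact ⟨⟨a, X, q', he, le_antisymm (hl' a X q' he) h⟩, hl'⟩
  · rintro ⟨⟨a, X, q', he, h⟩, hl⟩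
    refine ⟨⟨a, X, q', he, h.ge⟩, ?_⟩
    rintro u ⟨a, X, q', he, h⟩
    exact (hl a X q' he).trans h

lemma finite_trans_graph [Finite Q] [Finite A] [Fintype C] (M : StochasticAutomaton Q C A)
    (s : SAState Q C) :
    {p : SALabel A × ProbabilityMeasure (SAState Q C) | p.2 ∈ M.trans p.1 s}.Finite := by
  by_cases h : ∃ t, M.IsIdlingTime s t
  · obtain ⟨t, ht⟩ := h
    refine (Set.finite_range fun p : A × Q =>
      (((⟨p.1, t⟩ : SALabel A), M.enter p.2 fun c => s.clock c - t) :
        SALabel A × ProbabilityMeasure (SAState Q C))).subset ?_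
    rintro ⟨⟨a, u⟩, μ⟩ ⟨hu, X, q', -, -, hμ⟩
    obtain rfl : u = t := IsLeast.unique hu ht
    exact ⟨(a, q'), Prod.ext rfl hμ.symm⟩
  · convert Set.finite_empty
    ext p
    simp only [Set.mem_empty_iff_false, iff_false]
    exact fun hp => h ⟨_, hp.1⟩

/-- The semantics of a stochastic automaton as an NLMP. -/
noncomputable def toNLMP [Finite Q] [Finite A] [Fintype C] (M : StochasticAutomaton Q C A) :
    NLMP (SAState Q C) (SALabel A) where
  trans := M.trans
  measurableSet_trans a s :=
    (((M.finite_trans_graph s).image Prod.snd).subset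
      fun μ hμ => ⟨(a, μ), hμ, rfl⟩).measurableSet
  measurableSet_graph s := (M.finite_trans_graph s).measurableSet
  measurableSet_hit 𝒜 Y h𝒜 hY := by
    have key : {s : SAState Q C | ∃ l ∈ 𝒜, (M.trans l s ∩ Y).Nonempty} =
        ⋃ (q : Q) (a : A) (X : Set C) (q' : Q) (a₀ : A) (X₀ : Set C) (q₀ : Q),
          {s | s.loc = q} ∩ {s | M.edge q a X q' ∧ M.edge q a₀ X₀ q₀ ∧
            (∀ a X q', M.edge q a X q' → enablingTime X₀ s.clock ≤ enablingTime X s.clock) ∧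
            enablingTime X s.clock ≤ enablingTime X₀ s.clock ∧
            (⟨a, enablingTime X₀ s.clock⟩ : SALabel A) ∈ 𝒜 ∧
            (M.enter q' fun c => s.clock c - enablingTime X₀ s.clock) ∈ Y} := by
      ext ⟨q, ξ⟩
      simp only [Set.mem_iUnion, Set.mem_inter_iff]
      constructor
      · rintro ⟨⟨a, t⟩, hl, _, ⟨ht, X, q', he, hen, rfl⟩, hY'⟩
        rw [isIdlingTime_iff] at ht
        rw [enabled_iff] at hen
        obtain ⟨⟨a₀, X₀, q₀, he₀, ht₀⟩, hmin⟩ := ht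
        simp only at ht₀ hmin hen hY' he he₀
        subst ht₀
        exact ⟨q, a, X, q', a₀, X₀, q₀, rfl, he, he₀, hmin, hen, hl, hY'⟩
      · rintro ⟨q₁, a, X, q', a₀, X₀, q₀, rfl, he, he₀, hmin, hen, hl, hY'⟩
        refine ⟨_, hl, _, ⟨?_, X, q', he, ?_, rfl⟩, hY'⟩
        · rw [isIdlingTime_iff]
          exact ⟨⟨a₀, X₀, q₀, he₀, rfl⟩, hmin⟩
        · rw [enabled_iff]
          exact hen
    rw [key]
    refine MeasurableSet.iUnion fun q => MeasurableSet.iUnion fun a => MeasurableSet.iUnion fun X =>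
      MeasurableSet.iUnion fun q' => MeasurableSet.iUnion fun a₀ => MeasurableSet.iUnion fun X₀ =>
      MeasurableSet.iUnion fun q₀ => (SAState.measurableSet_loc q).inter ?_
    have hT : ∀ X : Set C, Measurable fun s : SAState Q C => enablingTime X s.clock := fun X =>
      (measurable_enablingTime X).comp SAState.measurable_clock
    have hmin : MeasurableSet {s : SAState Q C |
        ∀ a X q', M.edge q a X q' → enablingTime X₀ s.clock ≤ enablingTime X s.clock} := by
      simp only [Set.ofPred_forall]
      exact MeasurableSet.iInter fun a => MeasurableSet.iInter fun X => MeasurableSet.iInter fun q' =>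
        MeasurableSet.iInter fun _ => measurableSet_le (hT _) (hT _)
    refine (MeasurableSet.const _).inter ((MeasurableSet.const _).inter (hmin.inter
      ((measurableSet_le (hT _) (hT _)).inter (MeasurableSet.inter ?_ ?_))))
    · exact ((SALabel.measurable_mk a).comp (hT X₀)) h𝒜
    · refine (M.measurable_enter q').comp (measurable_pi_lambda _ fun c => ?_) hY
      exact ((measurable_pi_apply c).comp SAState.measurable_clock).sub (hT X₀).coe_nnreal_real

/-- The distribution that corresponds to a location `q`: the location is `q`, the clocks in `κ(q)`
are independent with laws `F c`, all other clocks are `0`. -/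
noncomputable def initial [Fintype C] (M : StochasticAutomaton Q C A) (q : Q) :
    ProbabilityMeasure (SAState Q C) :=
  M.enter q 0

/-- Probabilistic bisimilarity `q₁ ∼ q₂` of two locations of a stochastic automaton. -/
def LocBisimilar [Finite Q] [Finite A] [Fintype C] (M : StochasticAutomaton Q C A)
    (q₁ q₂ : Q) : Prop :=
  M.toNLMP.Bisimilar (M.initial q₁) (M.initial q₂)

variable {Q₁ Q₂ C₁ C₂ : Type*}

/-- The edges of the disjoint union. -/
inductive DisjUnionEdge (M₁ : StochasticAutomaton Q₁ C₁ A) (M₂ : StochasticAutomaton Q₂ C₂ A) :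
    Q₁ ⊕ Q₂ → A → Set (C₁ ⊕ C₂) → Q₁ ⊕ Q₂ → Prop
  | left {q a X q'} : M₁.edge q a X q' →
      DisjUnionEdge M₁ M₂ (Sum.inl q) a (Sum.inl '' X) (Sum.inl q')
  | right {q a X q'} : M₂.edge q a X q' →
      DisjUnionEdge M₁ M₂ (Sum.inr q) a (Sum.inr '' X) (Sum.inr q')

/-- The disjoint union of two stochastic automata (not a parallel composition). -/
def disjUnion (M₁ : StochasticAutomaton Q₁ C₁ A) (M₂ : StochasticAutomaton Q₂ C₂ A) :
    StochasticAutomaton (Q₁ ⊕ Q₂) (C₁ ⊕ C₂) A where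
  edge := DisjUnionEdge M₁ M₂
  reset := Sum.elim (fun q => Sum.inl '' M₁.reset q) (fun q => Sum.inr '' M₂.reset q)
  law := Sum.elim M₁.law M₂.law
  law_prob := by rintro (c | c) <;> exact law_prob _ _
  law_nonneg := by rintro (c | c) <;> exact law_nonneg _ _

/-- Two stochastic automata with initial locations `q₁` and `q₂` are bisimilar if these locations
are bisimilar in the disjoint union of the automata. -/
def Bisimilar [Finite Q₁] [Finite Q₂] [Finite A] [Fintype C₁] [Fintype C₂]
    (M₁ : StochasticAutomaton Q₁ C₁ A) (q₁ : Q₁)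
    (M₂ : StochasticAutomaton Q₂ C₂ A) (q₂ : Q₂) : Prop :=
  (disjUnion M₁ M₂).LocBisimilar (Sum.inl q₁) (Sum.inr q₂)

/-- The edges of the interleaving parallel composition. -/
inductive ParEdge (M₁ : StochasticAutomaton Q₁ C₁ A) (M₂ : StochasticAutomaton Q₂ C₂ A) :
    Q₁ × Q₂ × Fin 3 → A → Set (C₁ ⊕ C₂) → Q₁ × Q₂ × Fin 3 → Prop
  | left {q a X q'} (q₂ : Q₂) (b : Fin 3) : M₁.edge q a X q' →
      ParEdge M₁ M₂ (q, q₂, b) a (Sum.inl '' X) (q', q₂, 1)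
  | right {q a X q'} (q₁ : Q₁) (b : Fin 3) : M₂.edge q a X q' →
      ParEdge M₁ M₂ (q₁, q, b) a (Sum.inr '' X) (q₁, q', 2)

/-- The clock setting function of the interleaving parallel composition. -/
def parReset (M₁ : StochasticAutomaton Q₁ C₁ A) (M₂ : StochasticAutomaton Q₂ C₂ A) :
    Q₁ × Q₂ × Fin 3 → Set (C₁ ⊕ C₂)
  | (q₁, q₂, 0) => Sum.inl '' M₁.reset q₁ ∪ Sum.inr '' M₂.reset q₂
  | (q₁, _, 1) => Sum.inl '' M₁.reset q₁
  | (_, q₂, 2) => Sum.inr '' M₂.reset q₂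

/-- The full interleaving parallel composition. The clocks are the disjoint union of the clocks of
the components; the last component `b` of a location is `0` initially and says afterwards which of
the two automata moved last; only that automaton's clocks are set on entering the location. -/
def par (M₁ : StochasticAutomaton Q₁ C₁ A) (M₂ : StochasticAutomaton Q₂ C₂ A) :
    StochasticAutomaton (Q₁ × Q₂ × Fin 3) (C₁ ⊕ C₂) A where
  edge := ParEdge M₁ M₂
  reset := parReset M₁ M₂
  law := Sum.elim M₁.law M₂.law
  law_prob := by rintro (c | c) <;> exact law_prob _ _
  law_nonneg := by rintro (c | c) <;> exact law_nonneg _ _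

end StochasticAutomaton

/-! ### Continuous-time Markov chains -/

/-- A CTMC with state space `S` (finite in all uses), given by its rate matrix; `rate s s' = 0`
means that there is no transition from `s` to `s'`. -/
structure CTMC (S : Type*) where
  rate : Matrix S S ℝ≥0

namespace CTMC

variable {S S₁ S₂ : Type*}

/-- The interleaving parallel composition: the Kronecker sum of the rate matrices. -/
def par [DecidableEq S₁] [DecidableEq S₂] (𝒞₁ : CTMC S₁) (𝒞₂ : CTMC S₂) : CTMC (S₁ × S₂) where
  rate := 𝒞₁.rate ⊗ₖ (1 : Matrix S₂ S₂ ℝ≥0) + (1 : Matrix S₁ S₁ ℝ≥0) ⊗ₖ 𝒞₂.rate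

open Classical in
/-- The exponential distribution with rate `r > 0`. The value at `r = 0` is a placeholder for
clocks of absent transitions, which are never set and never occur in a trigger set. -/
noncomputable def expLaw (r : ℝ≥0) : Measure ℝ :=
  if 0 < r then ProbabilityTheory.expMeasure r else Measure.dirac 0

instance (r : ℝ≥0) : IsProbabilityMeasure (expLaw r) := by
  unfold expLaw
  split_ifs with h
  · exact ProbabilityTheory.isProbabilityMeasure_expMeasure h
  · infer_instance

lemma expLaw_nonneg (r : ℝ≥0) : expLaw r (Set.Iio 0) = 0 := by
  unfold expLaw
  split_ifs with h
  · rw [ProbabilityTheory.expMeasure, ProbabilityTheory.gammaMeasure,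
      withDensity_apply _ measurableSet_Iio]
    exact ProbabilityTheory.lintegral_gammaPDF_of_nonpos le_rfl
  · simp

/-- The stochastic automaton of a CTMC: it has a single action, and each transition (a pair of
states with positive rate) has its own exponentially distributed clock, which is set on entering
the source of the transition and triggers the transition. -/
noncomputable def toSA (𝒞 : CTMC S) : StochasticAutomaton S (S × S) Unit where
  edge s _ X s' := 0 < 𝒞.rate s s' ∧ X = {(s, s')}
  reset s := {c | c.1 = s ∧ 0 < 𝒞.rate c.1 c.2}
  law c := expLaw (𝒞.rate c.1 c.2)
  law_prob _ := inferInstance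
  law_nonneg _ := expLaw_nonneg _

end CTMC

/-! ### Races of independent exponential clocks. -/

namespace ExponentialRace

open ProbabilityTheory

/-! Both automata simulate the same Markov chain by exponential races; they differ in when clocks
are sampled. The automaton of the composed chain resamples every running clock after each jump,
while the interleaving composition resamples only the component that moved and keeps the residual
times of the other one. By memorylessness, these residual times are again independent and have their
original laws, so the two policies cannot be told apart.

To make this precise, call a distribution regular if, in each location, the running clocks are
independent with their original laws. In a race, the winner, the winning time and the residual times
of the losers are independent (`pi_expMeasure_race`). Hence a step from a regular distribution is
regular again, even after conditioning on the labels in `A` (`IsRace.isRegular_of_distStep`). Almost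
surely there is a unique winner, so schedulers have no influence (`IsRace.distStep_box`). Regular
distributions therefore evolve according to their location weights alone.

It remains to compare weights. A location is mapped to the pair of states of the two chains,
forgetting which automaton it belongs to and who moved last. The total rate into each pair depends
only on the current pair, because the Kronecker sum adds up exactly the rates of the interleaved
moves (`sum_parRate_mul`). So this map is a lumping, and regular distributions with equal class
weights form a bisimulation (`IsRace.isBisimulation`). Both initial distributions are regular and
lie over the same pair. -/

lemma expMeasure_eq_withDensity (r : ℝ) :
    expMeasure r = volume.withDensity (exponentialPDF r) := rfl

lemma measurable_exponentialPDF (r : ℝ) : Measurable (exponentialPDF r) :=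
  (measurable_exponentialPDFReal r).ennreal_ofReal

lemma ae_nonneg_expMeasure (r : ℝ) : ∀ᵐ t ∂expMeasure r, 0 ≤ t := by
  rw [expMeasure_eq_withDensity, ae_withDensity_iff (measurable_exponentialPDF r)]
  refine Filter.Eventually.of_forall fun t ht => ?_
  by_contra h
  exact ht (exponentialPDF_of_neg (not_le.1 h))

/-- The exponential distribution is memoryless. -/
lemma expMeasure_residual (r : ℝ) {t : ℝ} (ht : 0 ≤ t) {B : Set ℝ} (hB : MeasurableSet B) :
    expMeasure r {x | x - t ∈ Set.Ioi 0 ∩ B} =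
      ENNReal.ofReal (Real.exp (-(r * t))) * expMeasure r B := by
  have hS : MeasurableSet (Set.Ioi 0 ∩ B) := measurableSet_Ioi.inter hB
  have hm : MeasurableSet {x : ℝ | x - t ∈ Set.Ioi 0 ∩ B} := (measurable_id.sub_const t) hS
  -- Translating the integration variable by `t` turns the residual `x - t` into `x`; only the
  -- densities remain to be compared.
  rw [expMeasure_eq_withDensity, withDensity_apply _ hm, withDensity_apply _ hB,
    ← lintegral_indicator hm, ← lintegral_indicator hB,
    ← lintegral_add_right_eq_self (μ := volume) _ t,
    ← lintegral_const_mul _ ((measurable_exponentialPDF r).indicator hB)]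
  refine lintegral_congr_ae ?_
  -- At `x = 0` the two integrands may differ, since `Ioi 0` is open but the density does not vanish
  -- there.
  have h0 : ∀ᵐ x : ℝ, x ≠ 0 := by simp [ae_iff]
  filter_upwards [h0] with x hx
  by_cases hxB : x ∈ B
  · rcases lt_or_gt_of_ne hx with h | h
    · simp [hxB, h.not_gt, exponentialPDF_of_neg h, Set.indicator]
    · simp only [Set.indicator, Set.mem_ofPred_eq, add_sub_cancel_right, Set.mem_inter_iff,
        Set.mem_Ioi, h, hxB, and_self, if_true]
      rw [exponentialPDF_of_nonneg h.le, exponentialPDF_of_nonneg (add_nonneg h.le ht),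
        ← ENNReal.ofReal_mul (Real.exp_pos _).le, mul_left_comm, ← Real.exp_add]
      ring_nf
  · simp [hxB, Set.indicator]

/-- Fubini, with the coordinate `c` split off: once its value `t` is fixed, the conditions on the
other coordinates form a product set. -/
lemma pi_residual_eq_lintegral {ι : Type*} [Fintype ι] [DecidableEq ι] (μ : ι → Measure ℝ)
    [∀ i, SigmaFinite (μ i)] (c : ι) {T : Set ℝ} (hT : MeasurableSet T) {B : ι → Set ℝ}
    (hB : ∀ i, MeasurableSet (B i)) :
    Measure.pi μ {ξ | ξ c ∈ T ∧ ∀ d, d ≠ c → ξ d - ξ c ∈ B d} =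
      ∫⁻ t in T, ∏ d ∈ Finset.univ.erase c, μ d {x | x - t ∈ B d} ∂μ c := by
  have hS : MeasurableSet {ξ : ι → ℝ | ξ c ∈ T ∧ ∀ d, d ≠ c → ξ d - ξ c ∈ B d} := by
    have : {ξ : ι → ℝ | ξ c ∈ T ∧ ∀ d, d ≠ c → ξ d - ξ c ∈ B d} =
        (fun ξ => ξ c) ⁻¹' T ∩ ⋂ (d) (_ : d ≠ c), (fun ξ => ξ d - ξ c) ⁻¹' B d := by
      ext; simp
    rw [this]
    exact (measurable_pi_apply c hT).inter (MeasurableSet.iInter fun d =>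
      MeasurableSet.iInter fun _ => ((measurable_pi_apply d).sub (measurable_pi_apply c)) (hB d))
  have he := (measurePreserving_piEquivPiSubtypeProd μ (fun i => i = c)).symm
  have hu : MeasurePreserving (fun (t : ℝ) (_ : {i : ι // i = c}) => t) (μ c)
      (@Measure.pi _ _ (Subtype.fintype _) _ fun i : {i : ι // i = c} => μ i) := by
    convert (measurePreserving_piUnique (ι := {i : ι // i = c}) (fun i => μ i)).symm <;> rfl
  rw [← he.measure_preimage hS.nullMeasurableSet, Measure.prod_apply (he.measurable hS),
    ← hu.lintegral_comp (measurable_measure_prodMk_left (he.measurable hS)),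
    ← lintegral_indicator hT]
  refine lintegral_congr fun t => ?_
  have hpre : Prod.mk (fun _ : {i : ι // i = c} => t) ⁻¹'
      ((MeasurableEquiv.piEquivPiSubtypeProd (fun _ : ι => ℝ) fun i => i = c).symm ⁻¹'
      {ξ : ι → ℝ | ξ c ∈ T ∧ ∀ d, d ≠ c → ξ d - ξ c ∈ B d}) =
      {η | t ∈ T ∧ ∀ d : {i : ι // ¬ i = c}, η d - t ∈ B d} := by
    ext η
    simp only [Set.mem_preimage, Set.mem_ofPred_eq, MeasurableEquiv.piEquivPiSubtypeProd,
      MeasurableEquiv.symm_mk, MeasurableEquiv.coe_mk,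
      Equiv.piEquivPiSubtypeProd_symm_apply, dite_true, Subtype.forall]
    refine and_congr Iff.rfl (forall_congr' fun d => forall_congr' fun hd => ?_)
    rw [dif_neg hd]
  rw [hpre]
  by_cases ht : t ∈ T
  · simp only [ht, true_and, Set.indicator_of_mem]
    have : {η : {i : ι // ¬ i = c} → ℝ | ∀ d : {i : ι // ¬ i = c}, η d - t ∈ B d} =
        Set.univ.pi fun d : {i : ι // ¬ i = c} => {x | x - t ∈ B d} := by ext; simp
    rw [this, Measure.pi_pi]
    exact (Finset.prod_subtype (Finset.univ.erase c) (by simp)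
      fun d => μ d {x | x - t ∈ B d}).symm
  · simp [ht]

/-- In a race of independent exponential clocks, the winner, the time of its victory and the
residual times of the other clocks are independent; the latter have their original laws. -/
theorem pi_expMeasure_race {ι : Type*} [Fintype ι] [DecidableEq ι] (r : ι → ℝ≥0)
    (hr : ∀ i, 0 < r i) (c : ι) {T : Set ℝ} (hT : MeasurableSet T) {B : ι → Set ℝ}
    (hB : ∀ i, MeasurableSet (B i)) :
    Measure.pi (fun i => expMeasure (r i))
      {ξ | ξ c ∈ T ∧ ∀ d, d ≠ c → ξ d - ξ c ∈ Set.Ioi 0 ∩ B d} =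
      (r c : ℝ≥0∞) / ((∑ i, r i : ℝ≥0) : ℝ≥0∞) * expMeasure ((∑ i, r i : ℝ≥0) : ℝ) T *
        ∏ d ∈ Finset.univ.erase c, expMeasure (r d) (B d) := by
  have : ∀ i, IsProbabilityMeasure (expMeasure (r i)) := fun i =>
    isProbabilityMeasure_expMeasure (hr i)
  rw [pi_residual_eq_lintegral _ c hT fun i => measurableSet_Ioi.inter (hB i)]
  set E : ℝ≥0 := ∑ i, r i with hE
  have hcE : r c + ∑ i ∈ Finset.univ.erase c, r i = E :=
    Finset.add_sum_erase _ _ (Finset.mem_univ c)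
  have hE0 : 0 < E := hcE ▸ add_pos_of_pos_of_nonneg (hr c) zero_le
  -- Each loser `d` contributes a survival factor `exp (-(r d * t))`; together they decay with the
  -- sum of the losers' rates.
  have h1 : ∀ᵐ t ∂(expMeasure (r c)).restrict T,
      ∏ d ∈ Finset.univ.erase c, expMeasure (r d) {x | x - t ∈ Set.Ioi 0 ∩ B d} =
      ENNReal.ofReal (Real.exp (-((∑ i ∈ Finset.univ.erase c, r i : ℝ≥0) * t))) *
        ∏ d ∈ Finset.univ.erase c, expMeasure (r d) (B d) := by
    refine ae_restrict_of_ae ?_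
    filter_upwards [ae_nonneg_expMeasure (r c)] with t ht
    rw [Finset.prod_congr rfl fun d _ => expMeasure_residual (r d) ht (hB d),
      Finset.prod_mul_distrib, ← ENNReal.ofReal_prod_of_nonneg fun _ _ => (Real.exp_pos _).le,
      ← Real.exp_sum]
    push_cast
    rw [Finset.sum_neg_distrib, Finset.sum_mul]
  have hm : Measurable fun t : ℝ =>
      ENNReal.ofReal (Real.exp (-((∑ i ∈ Finset.univ.erase c, r i : ℝ≥0) * t))) := by fun_prop
  rw [lintegral_congr_ae h1, lintegral_mul_const _ hm]
  congr 1
  -- On densities, for `t ≥ 0`: `r c * exp (-(r c * t))` times the survival factor is `(r c / E) *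
  -- (E * exp (-(E * t)))`.
  rw [expMeasure_eq_withDensity, expMeasure_eq_withDensity,
    setLIntegral_withDensity_eq_setLIntegral_mul _ (measurable_exponentialPDF _) hm hT,
    withDensity_apply _ hT, ← lintegral_const_mul _ (measurable_exponentialPDF _)]
  refine lintegral_congr fun t => ?_
  rw [Pi.mul_apply]
  rcases lt_or_ge t 0 with ht | ht
  · simp [exponentialPDF_of_neg ht]
  · rw [exponentialPDF_of_nonneg ht, exponentialPDF_of_nonneg ht,
      ← ENNReal.ofReal_mul (by positivity), ← ENNReal.ofReal_coe_nnreal (p := r c),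
      ← ENNReal.ofReal_coe_nnreal (p := E), ← ENNReal.ofReal_div_of_pos (by exact_mod_cast hE0),
      ← ENNReal.ofReal_mul (by positivity), mul_assoc, ← Real.exp_add]
    have hE' : (E : ℝ) ≠ 0 := by exact_mod_cast hE0.ne'
    congr 1
    rw [← mul_assoc, div_mul_cancel₀ _ hE', ← hcE]
    push_cast
    ring_nf

end ExponentialRace

/-! ### Convex combinations and steps of distributions. -/

section ConvexCombination

variable {S : Type*} [MeasurableSpace S]

lemma IsConvexCombination.of_mem {M : Set (ProbabilityMeasure S)} {m : ProbabilityMeasure S}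
    (hm : m ∈ M) : IsConvexCombination M m :=
  ⟨⟨Measure.dirac m, inferInstance⟩, Measure.dirac_apply_of_mem hm, fun B hB => by
    simp [lintegral_dirac' _ (ProbabilityMeasure.measurable_eval hB)]⟩

lemma IsConvexCombination.nonempty {M : Set (ProbabilityMeasure S)} {μ : ProbabilityMeasure S}
    (h : IsConvexCombination M μ) : M.Nonempty := by
  obtain ⟨ν, hν, -⟩ := h
  refine Set.nonempty_iff_ne_empty.2 fun hM => ?_
  simp [hM] at hν

/-- Randomising over at most one choice changes nothing. Measurability of `M` turns `ν M = 1` into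
almost sure membership. -/
lemma IsConvexCombination.eq_of_subset_singleton {M : Set (ProbabilityMeasure S)}
    (hM : MeasurableSet M) {m μ : ProbabilityMeasure S} (h : IsConvexCombination M μ)
    (hs : M ⊆ {m}) : μ = m := by
  obtain ⟨ν, hν, hμ⟩ := h
  refine Subtype.ext (Measure.ext fun B hB => (hμ B hB).trans ?_)
  have : ∀ᵐ m' : ProbabilityMeasure S ∂(ν : Measure (ProbabilityMeasure S)),
      (m' : Measure S) B = (m : Measure S) B := by
    have hc : ∀ᵐ m' : ProbabilityMeasure S ∂(ν : Measure (ProbabilityMeasure S)), m' ∈ M :=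
      (prob_compl_eq_zero_iff hM).2 hν
    filter_upwards [hc] with m' hm'
    rw [hs hm']
  rw [lintegral_congr_ae this]
  simp

end ConvexCombination

namespace NLMP

variable {S L : Type*} [MeasurableSpace S] [MeasurableSpace L]

/-- A probability measure cannot be concentrated on the empty set, and Dirac measures realise the
single choices, so convex combinations do not affect which states are active. -/
lemma mem_active_iff (P : NLMP S L) {A : Set L} {s : S} :
    s ∈ P.active A ↔ ∃ a ∈ A, (P.trans a s).Nonempty :=
  ⟨fun ⟨_, a, ha, h⟩ => ⟨a, ha, h.nonempty⟩,
    fun ⟨a, ha, m, hm⟩ => ⟨m, a, ha, IsConvexCombination.of_mem hm⟩⟩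

/-- A measurable selection of steps from all active states gives a step of distributions. -/
lemma exists_distStep (P : NLMP S L) {A : Set L} {μ : ProbabilityMeasure S}
    (h0 : (μ : Measure S) (P.active A) ≠ 0) {f : S → ProbabilityMeasure S} (hf : Measurable f)
    (hs : ∀ s ∈ P.active A, P.SetStep A s (f s)) : ∃ μ', P.DistStep A μ μ' := by
  have hf' : Measurable fun s => (f s : Measure S) := measurable_subtype_coe.comp hf
  have hB : ∀ B, MeasurableSet B → (((μ : Measure S) (P.active A))⁻¹ •
      ((μ : Measure S).restrict (P.active A)).bind fun s => (f s : Measure S)) B =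
      ((μ : Measure S) (P.active A))⁻¹ *
          ∫⁻ s in P.active A, (f s : Measure S) B ∂(μ : Measure S) := fun B hB => by
    rw [Measure.smul_apply, Measure.bind_apply hB hf'.aemeasurable, smul_eq_mul]
  refine ⟨⟨_, ⟨?_⟩⟩, h0, f, hf, hs, hB⟩
  rw [hB _ MeasurableSet.univ]
  have : ∀ s, (f s : Measure S) Set.univ = 1 := fun s => measure_univ
  simp only [this, lintegral_const, one_mul, Measure.restrict_apply, MeasurableSet.univ,
    Set.univ_inter]
  exact ENNReal.inv_mul_cancel h0 (measure_ne_top _ _)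

end NLMP

/-! ### Boxes of clock values. -/

lemma ext_of_pi_univ {ι : Type*} [Fintype ι] {α : ι → Type*} [∀ i, MeasurableSpace (α i)]
    {μ ν : Measure (∀ i, α i)} [IsFiniteMeasure μ]
    (h : ∀ B : ∀ i, Set (α i), (∀ i, MeasurableSet (B i)) →
      μ (Set.univ.pi B) = ν (Set.univ.pi B)) : μ = ν := by
  refine ext_of_generate_finite _ generateFrom_pi.symm isPiSystem_pi ?_ ?_
  · rintro _ ⟨B, hB, rfl⟩
    exact h B fun i => hB i trivial
  · simpa using h (fun _ => Set.univ) fun _ => MeasurableSet.univ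

namespace SAState

variable {Q C : Type*}

/-- The states with location `q` and with values in `B c` of the clocks `c ∈ K`. -/
def box (q : Q) (K : Finset C) (B : C → Set ℝ) : Set (SAState Q C) :=
  {s | s.loc = q ∧ ∀ c ∈ K, s.clock c ∈ B c}

lemma measurable_clock_apply (c : C) : Measurable fun s : SAState Q C => s.clock c :=
  (measurable_pi_apply c).comp SAState.measurable_clock

lemma measurableSet_box (q : Q) (K : Finset C) {B : C → Set ℝ} (hB : ∀ c, MeasurableSet (B c)) :
    MeasurableSet (box q K B) := by
  have : box q K B = {s | s.loc = q} ∩ ⋂ c ∈ K, (fun s : SAState Q C => s.clock c) ⁻¹' B c := by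
    ext; simp [box]
  rw [this]
  exact (measurableSet_loc q).inter
    (K.measurableSet_biInter fun c _ => measurable_clock_apply c (hB c))

lemma box_univ (q : Q) (K : Finset C) :
    box q K (fun _ => Set.univ) = {s : SAState Q C | s.loc = q} := by
  ext; simp [box]

end SAState

/-! ### Race automata and regular distributions. -/

namespace StochasticAutomaton

open ProbabilityTheory ExponentialRace

variable {Q C : Type*}

open Classical in
-- Independence gives a product over `K`: clocks outside `K` are unconstrained and contribute 1, and
-- a clock that is not reset is a Dirac mass, hence the indicator.
lemma enterMeasure_box {A : Type*} [Fintype C] (M : StochasticAutomaton Q C A) (q q' : Q)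
    (η : C → ℝ) (K : Finset C) {B : C → Set ℝ} (hB : ∀ c, MeasurableSet (B c)) :
    M.enterMeasure q η (SAState.box q' K B) = if q = q' then
      ∏ c ∈ K, (if c ∈ M.reset q then M.law c (B c) else (B c).indicator 1 (η c)) else 0 := by
  have : ∀ c, IsProbabilityMeasure
      (if c ∈ M.reset q then M.law c else Measure.dirac (η c)) := fun c => by
    split_ifs <;> infer_instance
  rw [enterMeasure, Measure.map_apply (SAState.measurable_mk q) (SAState.measurableSet_box _ _ hB)]
  split_ifs with h
  · have : (fun ξ => (⟨q, ξ⟩ : SAState Q C)) ⁻¹' SAState.box q' K B =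
        Set.univ.pi fun c => if c ∈ K then B c else Set.univ := by
      ext ξ
      simp only [SAState.box, Set.mem_preimage, Set.mem_ofPred_eq, h, true_and, Set.mem_univ_pi]
      refine forall_congr' fun c => ?_
      by_cases hc : c ∈ K <;> simp [hc]
    rw [this, Measure.pi_pi, ← Finset.prod_subset K.subset_univ]
    · refine Finset.prod_congr rfl fun c hc => ?_
      rw [if_pos hc]
      split_ifs
      · rfl
      · exact Measure.dirac_apply' _ (hB c)
    · intro c _ hc
      rw [if_neg hc]
      exact measure_univ
  · have : (fun ξ => (⟨q, ξ⟩ : SAState Q C)) ⁻¹' SAState.box q' K B = ∅ := by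
      ext ξ
      simp [SAState.box, h]
    rw [this, measure_empty]

/-- In the location `q` of the automaton `M`, the clocks in `K q` are running and are exponentially
distributed; each of them triggers exactly one edge, with target `next q c`. -/
structure IsRace (M : StochasticAutomaton Q C Unit) (rate : C → ℝ≥0) (K : Q → Finset C)
    (next : Q → C → Q) : Prop where
  edge_iff : ∀ q a X q', M.edge q a X q' ↔ ∃ c ∈ K q, X = {c} ∧ q' = next q c
  law_eq : ∀ q, ∀ c ∈ K q, M.law c = expMeasure (rate c)
  rate_pos : ∀ q, ∀ c ∈ K q, 0 < rate c
  -- A clock that runs after the jump without having been reset is a loser of the race just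
  -- finished, so its value is a residual time.
  running : ∀ q, ∀ c ∈ K q, ∀ d ∈ K (next q c), d ∉ M.reset (next q c) → d ∈ K q ∧ d ≠ c

/-- A distribution on states is regular if in each location `q` the running clocks `K q` are
independent and have their original laws. -/
def IsRegular (M : StochasticAutomaton Q C Unit) (K : Q → Finset C)
    (μ : ProbabilityMeasure (SAState Q C)) : Prop :=
  ∀ (q : Q) (B : C → Set ℝ), (∀ c, MeasurableSet (B c)) →
    (μ : Measure (SAState Q C)) (SAState.box q (K q) B) =
      (μ : Measure (SAState Q C)) {s | s.loc = q} * ∏ c ∈ K q, M.law c (B c)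

/-- Regularity speaks only of boxes, but winning a race is not a box event. Boxes determine the
joint law of the running clocks. -/
lemma IsRegular.map_eq {M : StochasticAutomaton Q C Unit} {K : Q → Finset C}
    {μ : ProbabilityMeasure (SAState Q C)} (h : M.IsRegular K μ) (q : Q) :
    ((μ : Measure (SAState Q C)).restrict {s | s.loc = q}).map
      (fun s (c : K q) => s.clock c) =
      (μ : Measure (SAState Q C)) {s | s.loc = q} • Measure.pi fun c : K q => M.law c := by
  classical
  have hm : Measurable fun (s : SAState Q C) (c : K q) => s.clock c :=
    measurable_pi_lambda _ fun c => SAState.measurable_clock_apply c.1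
  refine ext_of_pi_univ fun B hB => ?_
  rw [Measure.map_apply hm (MeasurableSet.univ_pi hB), Measure.restrict_apply
    (hm (MeasurableSet.univ_pi hB)), Measure.smul_apply, Measure.pi_pi, smul_eq_mul]
  have := h q (fun c => if hc : c ∈ K q then B ⟨c, hc⟩ else ∅) fun c => by
    split_ifs
    · exact hB _
    · exact MeasurableSet.empty
  rw [← Finset.prod_coe_sort] at this
  convert this using 3
  · ext s
    simp only [SAState.box, Set.mem_inter_iff, Set.mem_preimage, Set.mem_univ_pi, Subtype.forall,
      Set.mem_ofPred_eq, and_comm (b := s.loc = q)]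
    refine and_congr Iff.rfl (forall_congr' fun c => forall_congr' fun hc => ?_)
    rw [dif_pos hc]
  · simp

/-- The states in `q` in which `c` is the first clock to expire. -/
def wins (K : Q → Finset C) (q : Q) (c : C) : Set (SAState Q C) :=
  {s | s.loc = q ∧ 0 ≤ s.clock c ∧ ∀ d ∈ K q, d ≠ c → s.clock c < s.clock d}

lemma measurableSet_wins (K : Q → Finset C) (q : Q) (c : C) : MeasurableSet (wins K q c) := by
  have : wins K q c = {s | s.loc = q} ∩ ({s | 0 ≤ s.clock c} ∩
      ⋂ d ∈ K q, ⋂ (_ : d ≠ c), {s | s.clock c < s.clock d}) := by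
    ext; simp [wins]
  rw [this]
  exact (SAState.measurableSet_loc q).inter
    ((measurableSet_le measurable_const (SAState.measurable_clock_apply c)).inter
    ((K q).measurableSet_biInter fun d _ => MeasurableSet.iInter fun _ =>
      measurableSet_lt (SAState.measurable_clock_apply c) (SAState.measurable_clock_apply d)))

/-- Victories are strict, so two different clocks cannot both win. -/
lemma wins_unique {K : Q → Finset C} {q q' : Q} {c c' : C} {s : SAState Q C}
    (hc : c ∈ K q) (hc' : c' ∈ K q') (h : s ∈ wins K q c) (h' : s ∈ wins K q' c') :
    q = q' ∧ c = c' := by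
  obtain ⟨rfl, -, h⟩ := h
  obtain ⟨rfl, -, h'⟩ := h'
  refine ⟨rfl, ?_⟩
  by_contra hne
  exact lt_asymm (h c' hc' (Ne.symm hne)) (h' c hc hne)

variable {M : StochasticAutomaton Q C Unit} {rate : C → ℝ≥0} {K : Q → Finset C}
  {next : Q → C → Q}

/-- The total rate of the running clocks in a location. -/
def exitRate (rate : C → ℝ≥0) (K : Q → Finset C) (q : Q) : ℝ≥0 := ∑ c ∈ K q, rate c

lemma IsRace.exitRate_pos (h : M.IsRace rate K next) {q : Q} {c : C} (hc : c ∈ K q) :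
    0 < exitRate rate K q :=
  (h.rate_pos q c hc).trans_le (Finset.single_le_sum (f := rate) (fun _ _ => zero_le) hc)

open Classical in
-- This is `pi_expMeasure_race` for the running clocks of `q`, transported to states by
-- `IsRegular.map_eq`.
lemma IsRace.measure_wins (h : M.IsRace rate K next) {μ : ProbabilityMeasure (SAState Q C)}
    (hμ : M.IsRegular K μ) {q : Q} {c : C} (hc : c ∈ K q) {T : Set ℝ} (hT : MeasurableSet T)
    {B : C → Set ℝ} (hB : ∀ d, MeasurableSet (B d)) :
    (μ : Measure (SAState Q C)) {s | s ∈ wins K q c ∧ s.clock c ∈ T ∧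
        ∀ d ∈ K q, d ≠ c → s.clock d - s.clock c ∈ B d} =
      (μ : Measure (SAState Q C)) {s | s.loc = q} *
        ((rate c : ℝ≥0∞) / (exitRate rate K q : ℝ≥0∞) * expMeasure (exitRate rate K q) T) *
        ∏ d ∈ (K q).erase c, M.law d (B d) := by
  have hm : Measurable fun (s : SAState Q C) (c : K q) => s.clock c :=
    measurable_pi_lambda _ fun c => SAState.measurable_clock_apply c.1
  set c₀ : K q := ⟨c, hc⟩
  set D : Set (K q → ℝ) := {ξ | ξ c₀ ∈ T ∩ Set.Ici 0 ∧
    ∀ d, d ≠ c₀ → ξ d - ξ c₀ ∈ Set.Ioi 0 ∩ B d} with hD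
  have hT' : MeasurableSet (T ∩ Set.Ici 0) := hT.inter measurableSet_Ici
  have hDm : MeasurableSet D := by
    have : D = (fun ξ => ξ c₀) ⁻¹' (T ∩ Set.Ici 0) ∩
        ⋂ (d) (_ : d ≠ c₀), (fun ξ => ξ d - ξ c₀) ⁻¹' (Set.Ioi 0 ∩ B d) := by
      ext; simp [hD]
    rw [this]
    exact (measurable_pi_apply c₀ hT').inter (MeasurableSet.iInter fun d =>
      MeasurableSet.iInter fun _ => ((measurable_pi_apply d).sub (measurable_pi_apply c₀))
        (measurableSet_Ioi.inter (hB d)))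
  have key := congrArg (fun m => m D) (hμ.map_eq q)
  simp only [Measure.smul_apply, smul_eq_mul] at key
  rw [Measure.map_apply hm hDm, Measure.restrict_apply (hm hDm)] at key
  have hlaw : (fun d : K q => M.law d) = fun d : K q => expMeasure (rate d) :=
    funext fun d => h.law_eq q d d.2
  have hsum : ∑ d : K q, rate d = exitRate rate K q := Finset.sum_coe_sort (K q) rate
  have hprod : ∏ d ∈ (Finset.univ : Finset (K q)).erase c₀, expMeasure (rate d) (B d) =
      ∏ d ∈ (K q).erase c, M.law d (B d) := by
    have : (K q).erase c = ((Finset.univ : Finset (K q)).erase c₀).map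
        (Function.Embedding.subtype _) := by
      ext d
      simp [c₀, and_comm]
    rw [this, Finset.prod_map]
    exact Finset.prod_congr rfl fun d _ => by rw [Function.Embedding.subtype_apply, h.law_eq q d d.2]
  -- The nonnegativity condition in `wins` costs no mass.
  have hexp : expMeasure (exitRate rate K q) (T ∩ Set.Ici 0) = expMeasure (exitRate rate K q) T :=
    measure_congr <| by
      filter_upwards [ae_nonneg_expMeasure (exitRate rate K q)] with t ht
      exact propext ⟨fun h => h.1, fun h => ⟨h, ht⟩⟩
  rw [hlaw, hD, pi_expMeasure_race (fun d : K q => rate d) (fun d => h.rate_pos q d d.2) c₀ hT'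
    fun d => hB d, hsum, hprod, hexp] at key
  rw [mul_assoc, ← key]
  congr 1
  ext s
  simp only [wins, Set.mem_ofPred_eq, Set.mem_inter_iff, Set.mem_preimage, Set.mem_Ici, Set.mem_Ioi,
    sub_pos, Subtype.forall, ne_eq, Subtype.mk.injEq, c₀]
  grind

/-- A strict, nonnegative minimum among the running clocks is the idling time, and at that time only
the edge of the winner is enabled; no nondeterminism is left. -/
lemma IsRace.trans_eq_of_wins [Fintype C] (h : M.IsRace rate K next) {q : Q} {c : C}
    (hc : c ∈ K q) {s : SAState Q C} (hs : s ∈ wins K q c) (l : SALabel Unit)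
    (m : ProbabilityMeasure (SAState Q C)) :
    m ∈ M.trans l s ↔ l.time = (s.clock c).toNNReal ∧
      m = M.enter (next q c) fun d => s.clock d - s.clock c := by
  obtain ⟨rfl, h0, hw⟩ := hs
  have hidle : M.IsIdlingTime s l.time ↔ l.time = (s.clock c).toNNReal := by
    have : {t : ℝ≥0 | ∃ a X q', M.edge s.loc a X q' ∧ Enabled X s.clock t} =
        Set.Ici (s.clock c).toNNReal := by
      ext t
      simp only [h.edge_iff, Set.mem_ofPred_eq, Set.mem_Ici, Real.toNNReal_le_iff_le_coe]
      constructor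
      · rintro ⟨_, _, _, ⟨d, hd, rfl, rfl⟩, hen⟩
        have hle : s.clock d ≤ t := sub_nonpos.1 (hen d rfl)
        by_cases hdc : d = c
        · exact hdc ▸ hle
        · exact (hw d hd hdc).le.trans hle
      · intro hle
        exact ⟨(), {c}, _, ⟨c, hc, rfl, rfl⟩, fun d hd => by
          rw [Set.mem_singleton_iff.1 hd]; exact sub_nonpos.2 hle⟩
    rw [IsIdlingTime, this]
    exact ⟨fun hl => hl.unique isLeast_Ici, fun hl => hl ▸ isLeast_Ici⟩
  simp only [trans, Set.mem_ofPred_eq, hidle]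
  refine and_congr_right fun ht => ?_
  have ht' : (l.time : ℝ) = s.clock c := by rw [ht, Real.coe_toNNReal _ h0]
  simp only [h.edge_iff, ht']
  constructor
  · rintro ⟨_, _, ⟨d, hd, rfl, rfl⟩, hen, rfl⟩
    have hle : s.clock d ≤ s.clock c := by
      have := hen d rfl
      rwa [ht', sub_nonpos] at this
    obtain rfl : d = c := by
      by_contra hdc
      exact (hw d hd hdc).not_ge hle
    rfl
  · rintro rfl
    refine ⟨{c}, _, ⟨c, hc, rfl, rfl⟩, fun d hd => ?_, rfl⟩
    rw [Set.mem_singleton_iff.1 hd, ht', sub_self]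

end StochasticAutomaton

/-! ### One step from a regular distribution. -/

namespace StochasticAutomaton

open ProbabilityTheory ExponentialRace

variable {Q C : Type*} {M : StochasticAutomaton Q C Unit} {rate : C → ℝ≥0} {K : Q → Finset C}
  {next : Q → C → Q}

/-- The winning probabilities `rate c / exitRate` add up to 1 and the winning events are disjoint,
so they exhaust the location. Ties and negative values are thereby null without a separate argument.
-/
lemma IsRace.ae_exists_wins [Finite Q] (h : M.IsRace rate K next)
    {μ : ProbabilityMeasure (SAState Q C)} (hμ : M.IsRegular K μ) :
    ∀ᵐ s ∂(μ : Measure (SAState Q C)), (K s.loc).Nonempty →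
      ∃ c ∈ K s.loc, s ∈ wins K s.loc c := by
  classical
  have key : ∀ q, (K q).Nonempty → ∀ᵐ s ∂(μ : Measure (SAState Q C)), s.loc = q →
      ∃ c ∈ K q, s ∈ wins K q c := by
    rintro q ⟨c₀, hc₀⟩
    have hE := h.exitRate_pos hc₀
    have := isProbabilityMeasure_expMeasure (r := exitRate rate K q) (by exact_mod_cast hE)
    have hsub : (⋃ c ∈ K q, wins K q c) ⊆ {s : SAState Q C | s.loc = q} :=
      Set.iUnion₂_subset fun c _ s hs => hs.1
    have hm : MeasurableSet (⋃ c ∈ K q, wins K q c) :=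
      (K q).measurableSet_biUnion fun c _ => measurableSet_wins K q c
    have hw : ∀ c ∈ K q, (μ : Measure (SAState Q C)) (wins K q c) =
        (μ : Measure (SAState Q C)) {s | s.loc = q} *
          ((rate c : ℝ≥0∞) / (exitRate rate K q : ℝ≥0∞)) := fun c hc => by
      have := h.measure_wins hμ hc MeasurableSet.univ (B := fun _ => Set.univ)
        fun _ => MeasurableSet.univ
      simpa using this
    have hU : (μ : Measure (SAState Q C)) (⋃ c ∈ K q, wins K q c) =
        (μ : Measure (SAState Q C)) {s | s.loc = q} := by
      rw [measure_biUnion_finset _ fun c _ => measurableSet_wins K q c, Finset.sum_congr rfl hw,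
        ← Finset.mul_sum]
      · simp only [div_eq_mul_inv]
        rw [← Finset.sum_mul, ← ENNReal.ofNNReal_finsetSum, ← exitRate,
          ENNReal.mul_inv_cancel (by exact_mod_cast hE.ne') ENNReal.coe_ne_top, mul_one]
      · exact fun c hc d hd hcd => Set.disjoint_left.2 fun s hs hs' =>
          hcd (wins_unique hc hd hs hs').2
    have h0 := measure_sdiff hsub hm.nullMeasurableSet (measure_ne_top (μ : Measure _) _)
    rw [hU, tsub_self] at h0
    rw [ae_iff]
    convert h0 using 2
    ext s
    simp
  have := ae_all_iff.2 fun q => Filter.eventually_imp_distrib_left.2 (key q)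
  filter_upwards [this] with s hs hK
  exact hs s.loc hK rfl

/-- The clock values at which a clock expires with a label in `A`. -/
def hitting (A : Set (SALabel Unit)) : Set ℝ := {x | (⟨(), x.toNNReal⟩ : SALabel Unit) ∈ A}

lemma measurableSet_hitting {A : Set (SALabel Unit)} (hA : MeasurableSet A) :
    MeasurableSet (hitting A) :=
  ((SALabel.measurable_mk ()).comp measurable_real_toNNReal) hA

/-- The probability that in the location `q` the clock `c` expires first, with a label in `A`. -/
noncomputable def winProb (rate : C → ℝ≥0) (K : Q → Finset C) (A : Set (SALabel Unit)) (q : Q)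
    (c : C) : ℝ≥0∞ :=
  (rate c : ℝ≥0∞) / (exitRate rate K q : ℝ≥0∞) * expMeasure (exitRate rate K q) (hitting A)

/-- The states in `q` in which `c` is the first clock to expire, with a label in `A`. -/
def winsIn (K : Q → Finset C) (A : Set (SALabel Unit)) (q : Q) (c : C) : Set (SAState Q C) :=
  {s | s ∈ wins K q c ∧ s.clock c ∈ hitting A}

lemma measurableSet_winsIn (K : Q → Finset C) {A : Set (SALabel Unit)} (hA : MeasurableSet A)
    (q : Q) (c : C) : MeasurableSet (winsIn K A q c) :=
  (measurableSet_wins K q c).inter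
    (SAState.measurable_clock_apply c (measurableSet_hitting hA))

lemma IsRace.mem_active_iff_of_wins [Finite Q] [Fintype C] (h : M.IsRace rate K next) {q : Q}
    {c : C} (hc : c ∈ K q) {s : SAState Q C} (hs : s ∈ wins K q c) {A : Set (SALabel Unit)} :
    s ∈ M.toNLMP.active A ↔ s.clock c ∈ hitting A := by
  rw [NLMP.mem_active_iff]
  constructor
  · rintro ⟨⟨⟨⟩, t⟩, ha, m, hm⟩
    obtain ⟨rfl, -⟩ := (h.trans_eq_of_wins hc hs _ m).1 hm
    exact ha
  · exact fun ha => ⟨_, ha, _, (h.trans_eq_of_wins hc hs _ _).2 ⟨rfl, rfl⟩⟩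

lemma IsRace.eq_enter_of_setStep [Finite Q] [Fintype C] (h : M.IsRace rate K next) {q : Q}
    {c : C} (hc : c ∈ K q) {s : SAState Q C} (hs : s ∈ wins K q c) {A : Set (SALabel Unit)}
    {m : ProbabilityMeasure (SAState Q C)} (hm : M.toNLMP.SetStep A s m) :
    m = M.enter (next q c) fun d => s.clock d - s.clock c := by
  obtain ⟨a, -, hm⟩ := hm
  exact hm.eq_of_subset_singleton (M.toNLMP.measurableSet_trans a s) fun m' hm' =>
    ((h.trans_eq_of_wins hc hs a m').1 hm').2

/-- Locations without running clocks have no edges and are inactive; elsewhere there is almost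
surely a winner, whose time decides about activity. -/
lemma IsRace.active_ae_eq [Fintype Q] [Fintype C] (h : M.IsRace rate K next)
    {μ : ProbabilityMeasure (SAState Q C)} (hμ : M.IsRegular K μ) (A : Set (SALabel Unit)) :
    M.toNLMP.active A =ᵐ[(μ : Measure (SAState Q C))]
      ⋃ p ∈ Finset.univ.sigma K, winsIn K A p.1 p.2 := by
  filter_upwards [h.ae_exists_wins hμ] with s hs
  refine propext ⟨fun ha => ?_, fun ha => ?_⟩
  · have hK : (K s.loc).Nonempty := by
      obtain ⟨a, -, m, -, X, q', he, -⟩ := M.toNLMP.mem_active_iff.1 ha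
      obtain ⟨c, hc, -⟩ := (h.edge_iff _ _ _ _).1 he
      exact ⟨c, hc⟩
    obtain ⟨c, hc, hw⟩ := hs hK
    exact Set.mem_iUnion₂.2 ⟨⟨s.loc, c⟩, by simpa using hc,
      hw, (h.mem_active_iff_of_wins hc hw).1 ha⟩
  · obtain ⟨⟨q, c⟩, hc, hw, ha⟩ := Set.mem_iUnion₂.1 ha
    exact (h.mem_active_iff_of_wins (by simpa using hc) hw).2 ha

lemma IsRace.setLIntegral_active [Fintype Q] [Fintype C] (h : M.IsRace rate K next)
    {μ : ProbabilityMeasure (SAState Q C)} (hμ : M.IsRegular K μ) {A : Set (SALabel Unit)}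
    (hA : MeasurableSet A) (g : SAState Q C → ℝ≥0∞) :
    ∫⁻ s in M.toNLMP.active A, g s ∂(μ : Measure (SAState Q C)) =
      ∑ q, ∑ c ∈ K q, ∫⁻ s in winsIn K A q c, g s ∂(μ : Measure (SAState Q C)) := by
  rw [setLIntegral_congr (h.active_ae_eq hμ A), lintegral_biUnion_finset _
    fun p _ => measurableSet_winsIn K hA p.1 p.2, Finset.sum_sigma]
  rintro ⟨q, c⟩ hc ⟨q', c'⟩ hc' hne
  refine Set.disjoint_left.2 fun s hs hs' => hne ?_
  obtain ⟨rfl, rfl⟩ := wins_unique (by simpa using hc) (by simpa using hc') hs.1 hs'.1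
  rfl

lemma IsRace.measure_active [Fintype Q] [Fintype C] (h : M.IsRace rate K next)
    {μ : ProbabilityMeasure (SAState Q C)} (hμ : M.IsRegular K μ) {A : Set (SALabel Unit)}
    (hA : MeasurableSet A) :
    (μ : Measure (SAState Q C)) (M.toNLMP.active A) =
      ∑ q, ∑ c ∈ K q, (μ : Measure (SAState Q C)) {s | s.loc = q} * winProb rate K A q c := by
  have := h.setLIntegral_active hμ hA fun _ => 1
  simp only [setLIntegral_one] at this
  rw [this]
  refine Finset.sum_congr rfl fun q _ => Finset.sum_congr rfl fun c hc => ?_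
  classical
  have := h.measure_wins hμ hc (measurableSet_hitting hA) (B := fun _ => Set.univ)
    fun _ => MeasurableSet.univ
  simpa [winsIn, winProb] using this

/-- The core of the argument. After the jump, a running clock is either freshly reset, giving a
constant factor, or a residual of a loser. By the race theorem the residuals are independent of the
winner and its time and have their original laws, so both kinds contribute the same factor `M.law d
(B d)`. -/
lemma IsRace.setLIntegral_enter_box [Fintype C] (h : M.IsRace rate K next)
    {μ : ProbabilityMeasure (SAState Q C)} (hμ : M.IsRegular K μ) {A : Set (SALabel Unit)}
    (hA : MeasurableSet A) {q q' : Q} {c : C} (hc : c ∈ K q) {B : C → Set ℝ}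
    (hB : ∀ c, MeasurableSet (B c)) [Decidable (next q c = q')] :
    ∫⁻ s in winsIn K A q c,
        M.enterMeasure (next q c) (fun d => s.clock d - s.clock c) (SAState.box q' (K q') B)
        ∂(μ : Measure (SAState Q C)) =
      (if next q c = q' then
        (μ : Measure (SAState Q C)) {s | s.loc = q} * winProb rate K A q c else 0) *
        ∏ d ∈ K q', M.law d (B d) := by
  classical
  simp only [enterMeasure_box _ _ _ _ _ hB]
  split_ifs with hq
  swap
  · simp
  subst hq
  -- The running clocks that carry residual times into the new location.
  set N : Finset C := {d ∈ K (next q c) | d ∉ M.reset (next q c)} with hN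
  set D : Set (SAState Q C) := {s | ∀ d ∈ N, s.clock d - s.clock c ∈ B d} with hD
  have hDm : MeasurableSet D := by
    have : D = ⋂ d ∈ N, (fun s : SAState Q C => s.clock d - s.clock c) ⁻¹' B d := by
      ext; simp [hD]
    rw [this]
    exact N.measurableSet_biInter fun d _ => ((SAState.measurable_clock_apply d).sub
      (SAState.measurable_clock_apply c)) (hB d)
  have hint : ∀ s : SAState Q C, ∏ d ∈ K (next q c), (if d ∈ M.reset (next q c) then
      M.law d (B d) else (B d).indicator 1 (s.clock d - s.clock c)) =
      (∏ d ∈ K (next q c) with d ∈ M.reset (next q c), M.law d (B d)) * D.indicator 1 s := by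
    intro s
    rw [Finset.prod_ite]
    congr 1
    by_cases hs : s ∈ D
    · rw [Set.indicator_of_mem hs]
      exact Finset.prod_eq_one fun d hd => Set.indicator_of_mem (hs d hd) _
    · rw [Set.indicator_of_notMem hs]
      simp only [hD, Set.mem_ofPred_eq, not_forall] at hs
      obtain ⟨d, hd, hs⟩ := hs
      exact Finset.prod_eq_zero hd (Set.indicator_of_notMem hs _)
  simp only [hint]
  rw [lintegral_const_mul _ (measurable_one.indicator hDm), lintegral_indicator_one hDm,
    Measure.restrict_apply hDm]
  have hND : ∀ d ∈ N, d ∈ K q ∧ d ≠ c := fun d hd => by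
    rw [hN, Finset.mem_filter] at hd
    exact h.running q c hc d hd.1 hd.2
  -- Losers that are reset or stop running are unconstrained, which brings the event into the form
  -- of `measure_wins`.
  have hset : D ∩ winsIn K A q c = {s | s ∈ wins K q c ∧ s.clock c ∈ hitting A ∧
      ∀ d ∈ K q, d ≠ c → s.clock d - s.clock c ∈ if d ∈ N then B d else Set.univ} := by
    ext s
    constructor
    · rintro ⟨h1, h2, h3⟩
      refine ⟨h2, h3, fun d _ _ => ?_⟩
      split_ifs with hd
      · exact h1 d hd
      · trivial
    · rintro ⟨h1, h2, h3⟩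
      refine ⟨fun d hd => ?_, h1, h2⟩
      simpa [hd] using h3 d (hND d hd).1 (hND d hd).2
  rw [hset, h.measure_wins hμ hc (measurableSet_hitting hA) fun d => by
    split_ifs
    · exact hB d
    · exact MeasurableSet.univ]
  have hprod : ∏ d ∈ (K q).erase c, M.law d (if d ∈ N then B d else Set.univ) =
      ∏ d ∈ N, M.law d (B d) := by
    rw [← Finset.prod_subset (s₁ := N)]
    · exact Finset.prod_congr rfl fun d hd => by rw [if_pos hd]
    · exact fun d hd => Finset.mem_erase.2 ⟨(hND d hd).2, (hND d hd).1⟩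
    · exact fun d _ hd => by rw [if_neg hd]; exact measure_univ
  rw [hprod, ← winProb, ← Finset.prod_filter_mul_prod_filter_not (K (next q c))
    (fun d => d ∈ M.reset (next q c)), mul_left_comm]

open Classical in
-- The right-hand side does not mention the scheduler: on winning states its value is forced, and
-- the other active states form a null set.
lemma IsRace.distStep_box [Fintype Q] [Fintype C] (h : M.IsRace rate K next)
    {μ μ' : ProbabilityMeasure (SAState Q C)} (hμ : M.IsRegular K μ) {A : Set (SALabel Unit)}
    (hA : MeasurableSet A) (hs : M.toNLMP.DistStep A μ μ') (q' : Q) {B : C → Set ℝ}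
    (hB : ∀ c, MeasurableSet (B c)) :
    (μ' : Measure (SAState Q C)) (SAState.box q' (K q') B) =
      ((μ : Measure (SAState Q C)) (M.toNLMP.active A))⁻¹ *
        (∑ q, ∑ c ∈ K q, if next q c = q' then
          (μ : Measure (SAState Q C)) {s | s.loc = q} * winProb rate K A q c else 0) *
        ∏ d ∈ K q', M.law d (B d) := by
  obtain ⟨-, f, -, hf, hμ'⟩ := hs
  rw [hμ' _ (SAState.measurableSet_box _ _ hB), h.setLIntegral_active hμ hA, mul_assoc]
  simp only [Finset.sum_mul]
  congr 1
  refine Finset.sum_congr rfl fun q _ => Finset.sum_congr rfl fun c hc => ?_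
  rw [← h.setLIntegral_enter_box hμ hA hc hB]
  refine setLIntegral_congr_fun (measurableSet_winsIn K hA q c) fun s hs => ?_
  rw [h.eq_enter_of_setStep hc hs.1 (hf s ((h.mem_active_iff_of_wins hc hs.1).2 hs.2))]
  rfl

open Classical in
lemma IsRace.distStep_loc [Fintype Q] [Fintype C] (h : M.IsRace rate K next)
    {μ μ' : ProbabilityMeasure (SAState Q C)} (hμ : M.IsRegular K μ) {A : Set (SALabel Unit)}
    (hA : MeasurableSet A) (hs : M.toNLMP.DistStep A μ μ') (q' : Q) :
    (μ' : Measure (SAState Q C)) {s | s.loc = q'} =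
      ((μ : Measure (SAState Q C)) (M.toNLMP.active A))⁻¹ *
        (∑ q, ∑ c ∈ K q, if next q c = q' then
          (μ : Measure (SAState Q C)) {s | s.loc = q} * winProb rate K A q c else 0) := by
  have := h.distStep_box hμ hA hs q' (B := fun _ => Set.univ) fun _ => MeasurableSet.univ
  rw [SAState.box_univ] at this
  simpa using this

/-- The clock values enter `distStep_box` only through the last product, and the remaining factor is
the weight of the location. -/
lemma IsRace.isRegular_of_distStep [Fintype Q] [Fintype C] (h : M.IsRace rate K next)
    {μ μ' : ProbabilityMeasure (SAState Q C)} (hμ : M.IsRegular K μ) {A : Set (SALabel Unit)}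
    (hA : MeasurableSet A) (hs : M.toNLMP.DistStep A μ μ') : M.IsRegular K μ' := fun q' B hB => by
  classical
  rw [h.distStep_box hμ hA hs q' hB, h.distStep_loc hμ hA hs]

end StochasticAutomaton

namespace StochasticAutomaton

open ProbabilityTheory ExponentialRace

variable {Q C : Type*} {M : StochasticAutomaton Q C Unit} {rate : C → ℝ≥0} {K : Q → Finset C}
  {next : Q → C → Q}

/-! ### Measurable schedulers -/

open Classical in
/-- The running clocks that expire first. -/
noncomputable def firstClocks (K : Q → Finset C) (s : SAState Q C) : Finset C :=
  {c ∈ K s.loc | ∀ d ∈ K s.loc, (s.clock c).toNNReal ≤ (s.clock d).toNNReal}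

lemma firstClocks_nonempty {s : SAState Q C} (hK : (K s.loc).Nonempty) :
    (firstClocks K s).Nonempty := by
  classical
  obtain ⟨c, hc, hmin⟩ := (K s.loc).exists_min_image (fun c => (s.clock c).toNNReal) hK
  refine ⟨c, ?_⟩
  simp only [firstClocks, Finset.mem_filter]
  exact ⟨hc, hmin⟩

lemma measurableSet_firstClocks_eq [Finite C] (K : Q → Finset C) (q : Q) (F : Finset C) :
    MeasurableSet {s : SAState Q C | s.loc = q ∧ firstClocks K s = F} := by
  classical
  have : {s : SAState Q C | s.loc = q ∧ firstClocks K s = F} = {s | s.loc = q} ∩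
      ⋂ c, {s | (c ∈ K q ∧ ∀ d ∈ K q, (s.clock c).toNNReal ≤ (s.clock d).toNNReal) ↔
        c ∈ F} := by
    ext s
    simp only [Set.mem_ofPred_eq, Set.mem_inter_iff, Set.mem_iInter, firstClocks, Finset.ext_iff,
      Finset.mem_filter]
    refine and_congr_right fun hq => ?_
    rw [hq]
  rw [this]
  refine (SAState.measurableSet_loc q).inter (MeasurableSet.iInter fun c => ?_)
  have hm : MeasurableSet {s : SAState Q C |
      c ∈ K q ∧ ∀ d ∈ K q, (s.clock c).toNNReal ≤ (s.clock d).toNNReal} := by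
    have : {s : SAState Q C | c ∈ K q ∧ ∀ d ∈ K q, (s.clock c).toNNReal ≤ (s.clock d).toNNReal} =
        {_s | c ∈ K q} ∩ ⋂ d ∈ K q, {s | (s.clock c).toNNReal ≤ (s.clock d).toNNReal} := by
      ext; simp
    rw [this]
    exact (MeasurableSet.const _).inter ((K q).measurableSet_biInter fun d _ => measurableSet_le
      (SAState.measurable_clock_apply c).real_toNNReal
      (SAState.measurable_clock_apply d).real_toNNReal)
  by_cases hF : c ∈ F
  · simpa only [hF, iff_true] using hm
  · simp only [hF, iff_false]
    exact hm.compl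

/-- This covers ties and negative clock values as well: a clock with negative value expires at time
0, so the least truncated value is the idling time. -/
lemma IsRace.enter_mem_trans [Fintype C] (h : M.IsRace rate K next) {s : SAState Q C} {c : C}
    (hc : c ∈ firstClocks K s) :
    (M.enter (next s.loc c) fun d => s.clock d - (s.clock c).toNNReal) ∈
      M.trans ⟨(), (s.clock c).toNNReal⟩ s := by
  obtain ⟨hcK, hmin⟩ : c ∈ K s.loc ∧
      ∀ d ∈ K s.loc, (s.clock c).toNNReal ≤ (s.clock d).toNNReal := by
    simpa only [firstClocks, Finset.mem_filter] using hc
  have hen : Enabled {c} s.clock (s.clock c).toNNReal := fun d hd => by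
    rw [Set.mem_singleton_iff.1 hd]
    exact sub_nonpos.2 (Real.le_coe_toNNReal _)
  have he : M.edge s.loc () {c} (next s.loc c) := (h.edge_iff _ _ _ _).2 ⟨c, hcK, rfl, rfl⟩
  refine ⟨⟨⟨_, _, _, he, hen⟩, ?_⟩, _, _, he, hen, rfl⟩
  rintro t ⟨_, _, _, he', hen'⟩
  obtain ⟨d, hd, rfl, rfl⟩ := (h.edge_iff _ _ _ _).1 he'
  exact (hmin d hd).trans (Real.toNNReal_le_iff_le_coe.2 (sub_nonpos.1 (hen' d rfl)))

/-- A step of distributions needs a measurable choice in every active state, including the null set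
of states without a strict winner. The choice may depend on the location and the set of first clocks
only; these take finitely many values, and for each of them the successor is measurable in the clock
values. -/
lemma IsRace.exists_scheduler [Finite Q] [Fintype C] (h : M.IsRace rate K next)
    (A : Set (SALabel Unit)) : ∃ f : SAState Q C → ProbabilityMeasure (SAState Q C),
      Measurable f ∧ ∀ s ∈ M.toNLMP.active A, M.toNLMP.SetStep A s (f s) := by
  classical
  -- The `else` branch is a dummy value: no first clock means no running clock, hence an inactive
  -- state.
  let g : (Q × Finset C) × SAState Q C → ProbabilityMeasure (SAState Q C) := fun p =>
    if hF : p.1.2.Nonempty then M.enter (next p.1.1 hF.choose)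
      fun d => p.2.clock d - (p.2.clock hF.choose).toNNReal else M.enter p.1.1 0
  let m : MeasurableSpace (Q × Finset C) := ⊤
  have : DiscreteMeasurableSpace (Q × Finset C) := ⟨fun _ => trivial⟩
  have hg : Measurable g := by
    refine measurable_from_prod_countable_right fun p => ?_
    by_cases hF : p.2.Nonempty
    · simp only [g, hF, dite_true]
      have hclock : Measurable fun (s : SAState Q C) d =>
          s.clock d - (s.clock hF.choose).toNNReal :=
        measurable_pi_lambda _ fun d => (SAState.measurable_clock_apply d).sub
          (SAState.measurable_clock_apply hF.choose).real_toNNReal.coe_nnreal_real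
      exact (M.measurable_enter (next p.1 hF.choose)).comp hclock
    · simp only [g, hF, dite_false]
      exact measurable_const
  have hi : Measurable fun s : SAState Q C => (s.loc, firstClocks K s) := by
    refine measurable_to_countable' fun p => ?_
    convert measurableSet_firstClocks_eq K p.1 p.2 using 1
    ext s
    exact Prod.ext_iff
  refine ⟨fun s => g ((s.loc, firstClocks K s), s), hg.comp (hi.prodMk measurable_id),
    fun s hs => ?_⟩
  obtain ⟨⟨⟨⟩, t⟩, ha, m', ht, X, q', he, -⟩ := M.toNLMP.mem_active_iff.1 hs
  obtain ⟨c, hc, -⟩ := (h.edge_iff _ _ _ _).1 he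
  have hF : (firstClocks K s).Nonempty := firstClocks_nonempty ⟨c, hc⟩
  have hmem := h.enter_mem_trans hF.choose_spec
  have ht' : t = (s.clock hF.choose).toNNReal := ht.unique hmem.1
  subst ht'
  refine ⟨_, ha, ?_⟩
  simp only [g, hF, dite_true]
  exact IsConvexCombination.of_mem hmem

/-! ### Lumping -/

/-- If every running clock is freshly set, regularity is the independence built into `enter`. -/
lemma isRegular_initial [Fintype C] {q : Q} (hq : ∀ c ∈ K q, c ∈ M.reset q) :
    M.IsRegular K (M.initial q) := by
  classical
  intro q' B hB
  have hbox : ∀ B : C → Set ℝ, (∀ c, MeasurableSet (B c)) →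
      (M.initial q : Measure (SAState Q C)) (SAState.box q' (K q') B) =
        if q = q' then ∏ c ∈ K q', M.law c (B c) else 0 := fun B hB => by
    refine (M.enterMeasure_box q q' 0 (K q') hB).trans ?_
    split_ifs with h
    · subst h
      exact Finset.prod_congr rfl fun c hc => if_pos (hq c hc)
    · rfl
  rw [← SAState.box_univ q' (K q'), hbox _ hB, hbox _ fun _ => MeasurableSet.univ]
  split_ifs <;> simp

lemma initial_loc [Fintype C] [DecidableEq Q] (q q' : Q) :
    (M.initial q : Measure (SAState Q C)) {s | s.loc = q'} = if q = q' then 1 else 0 := by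
  have := M.enterMeasure_box q q' 0 ∅ (B := fun _ => Set.univ) fun _ => MeasurableSet.univ
  rw [SAState.box_univ] at this
  refine Eq.trans this ?_
  simp

variable {P : Type*} {π : Q → P} {Γ : (P → ℝ≥0∞) → P → ℝ≥0∞}

/-- Here `Γ` is the rate operator of the lumped chain and `Γ 1` its exit rate. Thus the weighted
winning probabilities depend on `q` only through its class. -/
lemma sum_winProb_mul (hΓ : ∀ φ q, ∑ c ∈ K q, (rate c : ℝ≥0∞) * φ (π (next q c)) = Γ φ (π q))
    (A : Set (SALabel Unit)) (φ : P → ℝ≥0∞) (q : Q) :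
    ∑ c ∈ K q, winProb rate K A q c * φ (π (next q c)) =
      Γ φ (π q) / Γ 1 (π q) * expMeasure (Γ 1 (π q)).toNNReal (hitting A) := by
  have hE : Γ 1 (π q) = (exitRate rate K q : ℝ≥0∞) := by
    rw [← hΓ]
    simp [exitRate]
  rw [hE, ENNReal.toNNReal_coe, ← hΓ, div_eq_mul_inv, Finset.sum_mul, Finset.sum_mul]
  refine Finset.sum_congr rfl fun c _ => ?_
  rw [winProb, div_eq_mul_inv]
  ring

/-- Two regular distributions that give the same weight to each class of locations are bisimilar
if the classes form a lumping of the underlying Markov chain. -/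
theorem IsRace.isBisimulation [Fintype Q] [Fintype C] (h : M.IsRace rate K next)
    (hΓ : ∀ φ q, ∑ c ∈ K q, (rate c : ℝ≥0∞) * φ (π (next q c)) = Γ φ (π q)) :
    M.toNLMP.IsBisimulation fun μ ν => M.IsRegular K μ ∧ M.IsRegular K ν ∧ ∀ φ : P → ℝ≥0∞,
      ∑ q, (μ : Measure (SAState Q C)) {s | s.loc = q} * φ (π q) =
        ∑ q, (ν : Measure (SAState Q C)) {s | s.loc = q} * φ (π q) := by
  classical
  -- The quotient `Γ 1 (π q) / Γ 1 (π q)` is 1 for a positive exit rate and 0 for exit rate 0, where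
  -- `0 / 0 = 0` accounts for inactive locations.
  have hmass : ∀ {μ : ProbabilityMeasure (SAState Q C)}, M.IsRegular K μ →
      ∀ {A : Set (SALabel Unit)}, MeasurableSet A →
      (μ : Measure (SAState Q C)) (M.toNLMP.active A) =
        ∑ q, (μ : Measure (SAState Q C)) {s | s.loc = q} *
          (Γ 1 (π q) / Γ 1 (π q) * expMeasure (Γ 1 (π q)).toNNReal (hitting A)) := by
    intro μ hμ A hA
    rw [h.measure_active hμ hA]
    refine Finset.sum_congr rfl fun q _ => ?_
    rw [← sum_winProb_mul hΓ, ← Finset.mul_sum]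
    simp
  have hmass_eq : ∀ {μ ν : ProbabilityMeasure (SAState Q C)}, M.IsRegular K μ → M.IsRegular K ν →
      (∀ φ : P → ℝ≥0∞, ∑ q, (μ : Measure (SAState Q C)) {s | s.loc = q} * φ (π q) =
        ∑ q, (ν : Measure (SAState Q C)) {s | s.loc = q} * φ (π q)) →
      ∀ {A : Set (SALabel Unit)}, MeasurableSet A →
      (μ : Measure (SAState Q C)) (M.toNLMP.active A) =
        (ν : Measure (SAState Q C)) (M.toNLMP.active A) := by
    intro μ ν hμ hν hw A hA
    rw [hmass hμ hA, hmass hν hA]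
    exact hw fun p => Γ 1 p / Γ 1 p * expMeasure (Γ 1 p).toNNReal (hitting A)
  have hstep : ∀ {μ μ' : ProbabilityMeasure (SAState Q C)}, M.IsRegular K μ →
      ∀ {A : Set (SALabel Unit)}, MeasurableSet A → M.toNLMP.DistStep A μ μ' →
      ∀ φ : P → ℝ≥0∞, ∑ q, (μ' : Measure (SAState Q C)) {s | s.loc = q} * φ (π q) =
        ((μ : Measure (SAState Q C)) (M.toNLMP.active A))⁻¹ *
          ∑ q, (μ : Measure (SAState Q C)) {s | s.loc = q} *
            (Γ φ (π q) / Γ 1 (π q) * expMeasure (Γ 1 (π q)).toNNReal (hitting A)) := by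
    intro μ μ' hμ A hA hs φ
    simp only [h.distStep_loc hμ hA hs, mul_assoc]
    rw [← Finset.mul_sum]
    congr 1
    simp only [Finset.sum_mul, ite_mul, zero_mul]
    rw [Finset.sum_comm]
    refine Finset.sum_congr rfl fun q _ => ?_
    rw [Finset.sum_comm, ← sum_winProb_mul hΓ, Finset.mul_sum]
    refine Finset.sum_congr rfl fun c _ => ?_
    rw [Finset.sum_ite_eq, if_pos (Finset.mem_univ _), mul_assoc]
  refine ⟨fun μ ν hR => ⟨hR.2.1, hR.1, fun φ => (hR.2.2 φ).symm⟩,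
    fun μ ν ⟨hμ, hν, hw⟩ A hA => hmass_eq hμ hν hw hA, ?_⟩
  rintro μ ν ⟨hμ, hν, hw⟩ A hA μ' hs
  -- Any scheduler can answer the step, since its outcome has no influence on the location weights.
  obtain ⟨f, hf, hfs⟩ := h.exists_scheduler A
  obtain ⟨ν', hs'⟩ := M.toNLMP.exists_distStep (hmass_eq hμ hν hw hA ▸ hs.1) hf hfs
  refine ⟨ν', hs', h.isRegular_of_distStep hμ hA hs, h.isRegular_of_distStep hν hA hs', fun φ => ?_⟩
  rw [hstep hμ hA hs, hstep hν hA hs', hmass_eq hμ hν hw hA]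
  congr 1
  -- Testing the successors against `φ` amounts to testing `μ` and `ν` against another function of
  -- the class.
  exact hw fun p => Γ φ p / Γ 1 p * expMeasure (Γ 1 p).toNNReal (hitting A)

theorem IsRace.locBisimilar [Fintype Q] [Fintype C] (h : M.IsRace rate K next)
    (hΓ : ∀ φ q, ∑ c ∈ K q, (rate c : ℝ≥0∞) * φ (π (next q c)) = Γ φ (π q)) {q₁ q₂ : Q}
    (h₁ : ∀ c ∈ K q₁, c ∈ M.reset q₁) (h₂ : ∀ c ∈ K q₂, c ∈ M.reset q₂) (hπ : π q₁ = π q₂) :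
    M.LocBisimilar q₁ q₂ := by
  classical
  refine ⟨_, h.isBisimulation hΓ, isRegular_initial h₁, isRegular_initial h₂, fun φ => ?_⟩
  simp [initial_loc, hπ]

end StochasticAutomaton

/-! ### Parallel compositions of Markov chains -/

namespace CTMC

open StochasticAutomaton

variable {S₁ S₂ : Type*} [DecidableEq S₁] [DecidableEq S₂]

/-- The rates of the clocks in the disjoint union of the two parallel compositions. -/
def parRate (𝒞₁ : CTMC S₁) (𝒞₂ : CTMC S₂) :
    ((S₁ × S₁) ⊕ (S₂ × S₂)) ⊕ ((S₁ × S₂) × (S₁ × S₂)) → ℝ≥0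
  | .inl (.inl c) => 𝒞₁.rate c.1 c.2
  | .inl (.inr c) => 𝒞₂.rate c.1 c.2
  | .inr c => (𝒞₁.par 𝒞₂).rate c.1 c.2

/-- The pair of states of the two chains in a location. -/
def parState : (S₁ × S₂ × Fin 3) ⊕ (S₁ × S₂) → S₁ × S₂
  | .inl p => (p.1, p.2.1)
  | .inr p => p

/-- The clocks that belong to transitions out of the states of the two chains. -/
def IsSource : (S₁ × S₂ × Fin 3) ⊕ (S₁ × S₂) →
    ((S₁ × S₁) ⊕ (S₂ × S₂)) ⊕ ((S₁ × S₂) × (S₁ × S₂)) → Prop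
  | .inl p, .inl (.inl c) => c.1 = p.1
  | .inl p, .inl (.inr c) => c.1 = p.2.1
  | .inr p, .inr c => c.1 = p
  | .inl _, .inr _ => False
  | .inr _, .inl _ => False

open Classical in
/-- The running clocks in a location. -/
noncomputable def parClocks [Fintype S₁] [Fintype S₂] (𝒞₁ : CTMC S₁) (𝒞₂ : CTMC S₂)
    (q : (S₁ × S₂ × Fin 3) ⊕ (S₁ × S₂)) :
    Finset (((S₁ × S₁) ⊕ (S₂ × S₂)) ⊕ ((S₁ × S₂) × (S₁ × S₂))) :=
  {c | IsSource q c ∧ 0 < parRate 𝒞₁ 𝒞₂ c}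

/-- The location that is entered when a clock expires. -/
def parNext : (S₁ × S₂ × Fin 3) ⊕ (S₁ × S₂) →
    ((S₁ × S₁) ⊕ (S₂ × S₂)) ⊕ ((S₁ × S₂) × (S₁ × S₂)) → (S₁ × S₂ × Fin 3) ⊕ (S₁ × S₂)
  | .inl p, .inl (.inl c) => .inl (c.2, p.2.1, 1)
  | .inl p, .inl (.inr c) => .inl (p.1, c.2, 2)
  | .inl p, .inr _ => .inl p
  | .inr _, .inr c => .inr c.2
  | .inr p, .inl _ => .inr p

lemma expLaw_of_pos {r : ℝ≥0} (hr : 0 < r) : expLaw r = ProbabilityTheory.expMeasure r :=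
  if_pos hr

lemma par_rate_apply (𝒞₁ : CTMC S₁) (𝒞₂ : CTMC S₂) (p p' : S₁ × S₂) :
    (𝒞₁.par 𝒞₂).rate p p' = (if p.2 = p'.2 then 𝒞₁.rate p.1 p'.1 else 0) +
      if p.1 = p'.1 then 𝒞₂.rate p.2 p'.2 else 0 := by
  simp [par, Matrix.kroneckerMap_apply, Matrix.one_apply]

lemma coe_par_rate_apply (𝒞₁ : CTMC S₁) (𝒞₂ : CTMC S₂) (p p' : S₁ × S₂) :
    ((𝒞₁.par 𝒞₂).rate p p' : ℝ≥0∞) = (if p.2 = p'.2 then (𝒞₁.rate p.1 p'.1 : ℝ≥0∞) else 0) +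
      if p.1 = p'.1 then (𝒞₂.rate p.2 p'.2 : ℝ≥0∞) else 0 := by
  rw [par_rate_apply]
  split_ifs <;> simp

variable [Fintype S₁] [Fintype S₂]

lemma mem_parClocks {𝒞₁ : CTMC S₁} {𝒞₂ : CTMC S₂} {q : (S₁ × S₂ × Fin 3) ⊕ (S₁ × S₂)}
    {c : ((S₁ × S₁) ⊕ (S₂ × S₂)) ⊕ ((S₁ × S₂) × (S₁ × S₂))} :
    c ∈ parClocks 𝒞₁ 𝒞₂ q ↔ IsSource q c ∧ 0 < parRate 𝒞₁ 𝒞₂ c := by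
  simp [parClocks]

lemma isRace_disjUnion_par (𝒞₁ : CTMC S₁) (𝒞₂ : CTMC S₂) :
    (disjUnion (StochasticAutomaton.par 𝒞₁.toSA 𝒞₂.toSA) (𝒞₁.par 𝒞₂).toSA).IsRace
      (parRate 𝒞₁ 𝒞₂) (parClocks 𝒞₁ 𝒞₂) parNext where
  edge_iff q a X q' := by
    simp only [mem_parClocks]
    constructor
    · rintro ((⟨_, _, h, rfl⟩ | ⟨_, _, h, rfl⟩) | ⟨h, rfl⟩)
      · exact ⟨.inl (.inl (_, _)), ⟨rfl, h⟩, by simp, rfl⟩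
      · exact ⟨.inl (.inr (_, _)), ⟨rfl, h⟩, by simp, rfl⟩
      · exact ⟨.inr (_, _), ⟨rfl, h⟩, by simp, rfl⟩
    · rintro ⟨c, ⟨hc, h⟩, rfl, rfl⟩
      rcases q with ⟨p₁, p₂, b⟩ | p <;> rcases c with (⟨x, y⟩ | ⟨x, y⟩) | ⟨x, y⟩ <;>
        first | exact hc.elim | cases hc
      · rw [← Set.image_singleton, ← Set.image_singleton]
        exact .left (.left _ _ ⟨h, rfl⟩)
      · rw [← Set.image_singleton, ← Set.image_singleton]
        exact .left (.right _ _ ⟨h, rfl⟩)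
      · rw [← Set.image_singleton]
        exact .right ⟨h, rfl⟩
  law_eq q c hc := by
    simp only [mem_parClocks] at hc
    rcases c with (c | c) | c <;> exact expLaw_of_pos hc.2
  rate_pos q c hc := by
    simp only [mem_parClocks] at hc
    exact hc.2
  -- In the interleaving, a running clock that is not reset belongs to the component that did not
  -- move; its state is unchanged, so the clock was already running and is not `c`. In the composed
  -- chain all running clocks are reset.
  running q c hc d hd hr := by
    simp only [mem_parClocks] at hc hd ⊢
    rcases q with ⟨p₁, p₂, b⟩ | p <;> rcases c with (⟨x, y⟩ | ⟨x, y⟩) | ⟨x, y⟩ <;>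
      rcases d with (⟨x', y'⟩ | ⟨x', y'⟩) | ⟨x', y'⟩ <;>
      simp [IsSource, parRate, parNext, disjUnion, StochasticAutomaton.par, parReset, toSA]
        at hc hd hr ⊢ <;>
      grind

/-- Each entry of the Kronecker sum adds the rates of the left and right moves between two pairs.
Clocks need not correspond one to one: self-loops of the two components have two clocks in the
interleaving but merge into one transition of the composed chain. Only the summed rates agree. -/
lemma sum_parRate_mul (𝒞₁ : CTMC S₁) (𝒞₂ : CTMC S₂) (φ : S₁ × S₂ → ℝ≥0∞)
    (q : (S₁ × S₂ × Fin 3) ⊕ (S₁ × S₂)) :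
    ∑ c ∈ parClocks 𝒞₁ 𝒞₂ q, (parRate 𝒞₁ 𝒞₂ c : ℝ≥0∞) * φ (parState (parNext q c)) =
      ∑ p, ((𝒞₁.par 𝒞₂).rate (parState q) p : ℝ≥0∞) * φ p := by
  classical
  have hK : parClocks 𝒞₁ 𝒞₂ q = ({c | IsSource q c} : Finset _).filter
      fun c => 0 < parRate 𝒞₁ 𝒞₂ c := by
    ext; simp [mem_parClocks]
  -- Clocks of rate 0 contribute nothing, so the positivity condition can be dropped.
  rw [hK, Finset.sum_filter_of_ne fun c _ hc => pos_iff_ne_zero.2 fun h0 => hc (by simp [h0]),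
    Finset.sum_filter]
  rcases q with ⟨p₁, p₂, b⟩ | p
  · have h₁ : ∀ x y : S₁, IsSource (.inl (p₁, p₂, b)) (.inl (.inl (x, y))) ↔ x = p₁ :=
      fun _ _ => ⟨id, id⟩
    have h₂ : ∀ x y : S₂, IsSource (.inl (p₁, p₂, b)) (.inl (.inr (x, y))) ↔ x = p₂ :=
      fun _ _ => ⟨id, id⟩
    have h₃ : ∀ c : (S₁ × S₂) × (S₁ × S₂), IsSource (.inl (p₁, p₂, b)) (.inr c) ↔ False :=
      fun _ => ⟨id, id⟩
    simp only [Fintype.sum_sum_type, h₃, Fintype.sum_prod_type (α₁ := S₁) (α₂ := S₁),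
      Fintype.sum_prod_type (α₁ := S₂), h₁, h₂,
      parRate, parNext, parState,
      coe_par_rate_apply, if_false, Finset.sum_const_zero, add_zero, add_mul,
      Finset.sum_add_distrib]
    congr 1
    · rw [Finset.sum_comm, Fintype.sum_prod_type]
      exact Finset.sum_congr rfl fun y _ => by simp
    · rw [Finset.sum_comm, Fintype.sum_prod_type_right]
      exact Finset.sum_congr rfl fun y _ => by simp
  · have h₁ : ∀ c : (S₁ × S₁) ⊕ (S₂ × S₂), IsSource (.inr p) (.inl c) ↔ False :=
      fun _ => ⟨id, id⟩
    have h₂ : ∀ x y : S₁ × S₂, IsSource (.inr p) (.inr (x, y)) ↔ x = p := fun _ _ => ⟨id, id⟩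
    rw [Fintype.sum_sum_type, Fintype.sum_prod_type (α₁ := S₁ × S₂), Finset.sum_comm]
    simp only [h₁, h₂, parRate, parNext, parState, if_false, Finset.sum_const_zero, zero_add]
    exact Finset.sum_congr rfl fun y _ => by simp

end CTMC

theorem mainTheorem1 {S₁ S₂ : Type*} [Fintype S₁] [DecidableEq S₁] [Fintype S₂] [DecidableEq S₂]
    (𝒞₁ : CTMC S₁) (𝒞₂ : CTMC S₂) (s₁ : S₁) (s₂ : S₂) :
    StochasticAutomaton.Bisimilar
      (StochasticAutomaton.par 𝒞₁.toSA 𝒞₂.toSA) (s₁, s₂, 0)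
      (CTMC.toSA (CTMC.par 𝒞₁ 𝒞₂)) (s₁, s₂) := by
  -- The lumped chain is the composed chain itself, with its rate matrix acting on functions.
  refine (CTMC.isRace_disjUnion_par 𝒞₁ 𝒞₂).locBisimilar (π := CTMC.parState)
    (Γ := fun φ p => ∑ p', ((𝒞₁.par 𝒞₂).rate p p' : ℝ≥0∞) * φ p')
    (CTMC.sum_parRate_mul 𝒞₁ 𝒞₂) ?_ ?_ rfl <;>
  -- Every running clock is fresh initially: the tag `0` resets the clocks of both components, and
  -- the composed chain always resets all of them.
  · intro c hc
    rw [CTMC.mem_parClocks] at hc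
    rcases c with (⟨x, y⟩ | ⟨x, y⟩) | ⟨x, y⟩ <;>
      simp [CTMC.IsSource, CTMC.parRate] at hc <;>
      simp [StochasticAutomaton.disjUnion, StochasticAutomaton.par, StochasticAutomaton.parReset,
        CTMC.toSA] <;>
      grind
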